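/- Let $n,k\ge 0$ be integers. Let $C(n)$ be the complex Clifford algebra with generators $\omega_1,\dots,\omega_n$ and relations $\omega_i\omega_j+\omega_j\omega_i=2\delta_{ij}$, and let $W_{2k}$ be the complex Weyl algebra with generators $p_1,q_1,\dots,p_k,q_k$ and relations $p_iq_j-q_jp_i=\delta_{ij}$, $p_ip_j=p_jp_i$, $q_iq_j=q_jq_i$. Both are $\mathbb Z_2$-graded with all generators of degree $1$, and the Clifford–Weyl algebra is the graded tensor product $C(n,2k)=C(n)\otimes_{\mathbb Z_2}W_{2k}$, so that each $\omega_i$ anticommutes with all $p_j$ and $q_j$. Let $\Delta_2$ be the $\mathbb Z_2$-grading of the algebra $C(n,2k)$ in which the $\omega_i$ have degree $0$ and the $p_j,q_j$ have degree $1$, and let $[\cdot,\cdot]$ be the associated super bracket: $[a,b]=ab-(-1)^{\Delta_2(a)\Delta_2(b)}ba$ for homogeneous $a,b$. Put $V_{\bar0}=\operatorname{span}\{\omega_1,\dots,\omega_n\}$, $V_{\bar1}=\operatorname{span}\{p_1,q_1,\dots,p_k,q_k\}$ and $V=V_{\bar0}\oplus V_{\bar1}$; for subspaces $U,W$ let $[U,W]$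 be the linear span of the brackets $[u,w]$, $u\in U$, $w\in W$. For $m\ge0$ let $\mathfrak{osp}(m,2k)$ be the Lie superalgebra, inside $\mathfrak{gl}(m|2k)$ with its super bracket, spanned by the homogeneous $X$ such that $F(Xu,v)=-(-1)^{\deg X\deg u}F(u,Xv)$ for all homogeneous $u,v\in\mathbb C^{m|2k}$, where $F$ is the standard non-degenerate even supersymmetric bilinear form on $\mathbb C^{m|2k}$. Isomorphisms below are isomorphisms of complex Lie superalgebras (even linear bijections preserving the super bracket), a Lie algebra being a purely even Lie superalgebra. **Proposition 4.1 (Palev's theorem).** The sum $V+[V,V]$ is direct, and $\mathfrak g=V\oplus[V,V]$ is a Lie sub-superalgebra of $C(n,2k)$; it is the Lie sub-superalgebra generated by $V$, and it is isomorphic to $\mathfrak{osp}(n+1,2k)$. Moreover $$\mathfrak g_{\bar0}=V_{\bar0}\oplus[V_{\bar0},V_{\bar0}]\oplus[V_{\bar1},V_{\bar1}],$$ where $[V_{\bar0},V_{\bar0}]$, $[V_{\bar1},V_{\bar1}]$ and $V_{\bar0}\oplus[V_{\bar0},V_{\bar0}]$ are Lie sub-superalgebras with $[V_{\bar0},V_{\bar0}]\simeq\mathfrak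 o(n)$, $[V_{\bar1},V_{\bar1}]\simeq\mathfrak{sp}(2k)$, $V_{\bar0}\oplus[V_{\bar0},V_{\bar0}]\simeq\mathfrak o(n+1)$, and $\mathfrak g_{\bar0}\simeq\mathfrak o(n+1)\times\mathfrak{sp}(2k)$. Also $$\mathfrak g_{\bar1}=V_{\bar1}\oplus[V_{\bar0},V_{\bar1}],$$ and $V_{\bar1}\oplus[V_{\bar1},V_{\bar1}]$ is a Lie sub-superalgebra isomorphic to $\mathfrak{osp}(1,2k)$. Finally $\mathfrak h=[V_{\bar0},V_{\bar0}]\oplus[V_{\bar1},V_{\bar1}]\oplus[V_{\bar0},V_{\bar1}]$ equals $[V,V]$ and is a Lie sub-superalgebra isomorphic to $\mathfrak{osp}(n,2k)$. -/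

import Mathlib

open scoped TensorProduct

noncomputable section

namespace CliffordWeyl

/-! ### Superalgebras and the super bracket -/

section Super

variable {A : Type*} [Ring A] [Algebra ℂ A]

/-- A family of subspaces indexed by `ℤ/2`, multiplicative and with `A = 𝒜 0 ⊕ 𝒜 1`, is a
`ℤ/2`-grading of the algebra `A`. -/
@[reducible] def gradedAlgebraOfSplit (𝒜 : ZMod 2 → Submodule ℂ A) [SetLike.GradedMonoid 𝒜]
    (hdisj : Disjoint (𝒜 0) (𝒜 1)) (hsup : 𝒜 0 ⊔ 𝒜 1 = ⊤) : GradedAlgebra 𝒜 :=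
  { (DirectSum.IsInternal.chooseDecomposition 𝒜
      ((DirectSum.isInternal_submodule_iff_isCompl 𝒜 (i := 0) (j := 1) (by decide)
        (by
          ext x
          have h : ∀ y : ZMod 2, y = 0 ∨ y = 1 := by decide
          simpa using h x)).mpr
          ⟨hdisj, codisjoint_iff.mpr hsup⟩)) with }

/-- The subspaces `{a | σ a = a}` (degree `0`) and `{a | σ a = -a}` (degree `1`) attached to an
algebra endomorphism `σ`. -/
def parityGrading (σ : A →ₐ[ℂ] A) (i : ZMod 2) : Submodule ℂ A :=
  LinearMap.ker (σ.toLinearMap - ((-1 : ℂ) ^ i.val) • LinearMap.id)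

lemma mem_parityGrading (σ : A →ₐ[ℂ] A) (i : ZMod 2) (a : A) :
    a ∈ parityGrading σ i ↔ σ a = ((-1 : ℂ) ^ i.val) • a := by
  simp [parityGrading, sub_eq_zero]

lemma neg_one_pow_val_add (i j : ZMod 2) :
    ((-1 : ℂ) ^ (i + j).val) = (-1) ^ i.val * (-1) ^ j.val := by
  have h : ∀ i j : ZMod 2, (i + j).val % 2 = (i.val + j.val) % 2 := by decide
  rw [← pow_add, neg_one_pow_eq_pow_mod_two, h i j, ← neg_one_pow_eq_pow_mod_two]

instance parityGrading_gradedMonoid (σ : A →ₐ[ℂ] A) :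
    SetLike.GradedMonoid (parityGrading σ) where
  one_mem := by simp [mem_parityGrading]
  mul_mem i j a b ha hb := by
    rw [mem_parityGrading] at *
    rw [map_mul, ha, hb, neg_one_pow_val_add, smul_mul_smul_comm]

/-- An involutive automorphism of a complex algebra is the same thing as a `ℤ/2`-grading. -/
@[reducible] def parityGradedAlgebra (σ : A →ₐ[ℂ] A) (hσ : ∀ a, σ (σ a) = a) :
    GradedAlgebra (parityGrading σ) :=
  gradedAlgebraOfSplit (parityGrading σ)
    (by
      rw [Submodule.disjoint_def]
      intro x h0 h1
      rw [mem_parityGrading] at h0 h1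
      have h : x = -x := by simpa [ZMod.val_one] using h0.symm.trans h1
      have h2 : (2 : ℂ) • x = 0 := by
        rw [two_smul]
        nth_rewrite 2 [h]
        exact add_neg_cancel x
      exact (smul_eq_zero.mp h2).resolve_left two_ne_zero)
    (by
      rw [eq_top_iff]
      intro x _
      have hx : x = (2⁻¹ : ℂ) • (x + σ x) + (2⁻¹ : ℂ) • (x - σ x) := by
        rw [← smul_add, add_add_sub_cancel, ← two_smul ℂ x, smul_smul]
        norm_num
      rw [hx]
      refine Submodule.add_mem_sup ?_ ?_
      · rw [mem_parityGrading]
        simp [hσ, add_comm]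
      · rw [mem_parityGrading]
        simp [hσ, ZMod.val_one, ← smul_neg])

variable (𝒜 : ZMod 2 → Submodule ℂ A) [GradedAlgebra 𝒜]

lemma proj_of_mem {i : ZMod 2} {a : A} (ha : a ∈ 𝒜 i) (j : ZMod 2) :
    GradedAlgebra.proj 𝒜 j a = if j = i then a else 0 := by
  rw [GradedAlgebra.proj_apply]
  split_ifs with h
  · subst h; exact DirectSum.decompose_of_mem_same 𝒜 ha
  · exact DirectSum.decompose_of_mem_ne 𝒜 ha (Ne.symm h)

lemma proj_mem (i : ZMod 2) (a : A) : GradedAlgebra.proj 𝒜 i a ∈ 𝒜 i := by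
  rw [GradedAlgebra.proj_apply]
  exact SetLike.coe_mem _

lemma eq_proj_add_proj (a : A) : a = GradedAlgebra.proj 𝒜 0 a + GradedAlgebra.proj 𝒜 1 a := by
  have hu : (Finset.univ : Finset (ZMod 2)) = {0, 1} := by decide
  have h : ∑ i : ZMod 2, GradedAlgebra.proj 𝒜 i a = a := by
    classical
    conv_rhs => rw [← DirectSum.sum_support_decompose 𝒜 a]
    refine (Finset.sum_subset (Finset.subset_univ _) fun i _ hi => ?_).symm
    simpa using hi
  rw [hu, Finset.sum_pair (by decide)] at h
  exact h.symm

/-- The super bracket of a `ℤ/2`-graded associative algebra: the bilinear map with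
`[a, b] = a b - (-1)^(i j) b a` for `a` of degree `i` and `b` of degree `j`. -/
def superBracket : A →ₗ[ℂ] A →ₗ[ℂ] A :=
  ∑ i : ZMod 2, ∑ j : ZMod 2,
    (LinearMap.mul ℂ A - ((-1 : ℂ) ^ (i.val * j.val)) • (LinearMap.mul ℂ A).flip).compl₁₂
      (GradedAlgebra.proj 𝒜 i) (GradedAlgebra.proj 𝒜 j)

lemma superBracket_of_mem {i j : ZMod 2} {a b : A} (ha : a ∈ 𝒜 i) (hb : b ∈ 𝒜 j) :
    superBracket 𝒜 a b = a * b - ((-1 : ℂ) ^ (i.val * j.val)) • (b * a) := by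
  simp only [superBracket, LinearMap.sum_apply, LinearMap.compl₁₂_apply, proj_of_mem 𝒜 ha,
    proj_of_mem 𝒜 hb]
  rw [Finset.sum_eq_single i, Finset.sum_eq_single j]
  · simp
  · intro j' _ hj'; simp [hj']
  · simp
  · intro i' _ hi'; simp [hi']
  · simp

lemma superBracket_mem {i j : ZMod 2} {a b : A} (ha : a ∈ 𝒜 i) (hb : b ∈ 𝒜 j) :
    superBracket 𝒜 a b ∈ 𝒜 (i + j) := by
  rw [superBracket_of_mem 𝒜 ha hb]
  refine Submodule.sub_mem _ (SetLike.mul_mem_graded ha hb) (Submodule.smul_mem _ _ ?_)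
  rw [add_comm]
  exact SetLike.mul_mem_graded hb ha

/-- Super antisymmetry of the super bracket. -/
lemma superBracket_skew {i j : ZMod 2} {a b : A} (ha : a ∈ 𝒜 i) (hb : b ∈ 𝒜 j) :
    superBracket 𝒜 a b = -(((-1 : ℂ) ^ (i.val * j.val)) • superBracket 𝒜 b a) := by
  rw [superBracket_of_mem 𝒜 ha hb, superBracket_of_mem 𝒜 hb ha, mul_comm j.val]
  rcases neg_one_pow_eq_or ℂ (i.val * j.val) with h | h <;> rw [h] <;> module

/-- The super Jacobi identity: together with super antisymmetry it says that the super bracket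
makes `A` a Lie superalgebra. -/
lemma superBracket_jacobi {i j l : ZMod 2} {a b c : A} (ha : a ∈ 𝒜 i) (hb : b ∈ 𝒜 j)
    (hc : c ∈ 𝒜 l) :
    superBracket 𝒜 a (superBracket 𝒜 b c) = superBracket 𝒜 (superBracket 𝒜 a b) c +
      ((-1 : ℂ) ^ (i.val * j.val)) • superBracket 𝒜 b (superBracket 𝒜 a c) := by
  rw [superBracket_of_mem 𝒜 ha (superBracket_mem 𝒜 hb hc),
    superBracket_of_mem 𝒜 (superBracket_mem 𝒜 ha hb) hc,
    superBracket_of_mem 𝒜 hb (superBracket_mem 𝒜 ha hc),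
    superBracket_of_mem 𝒜 hb hc, superBracket_of_mem 𝒜 ha hb, superBracket_of_mem 𝒜 ha hc]
  have h1 : ((-1 : ℂ) ^ (i.val * (j + l).val)) =
      (-1) ^ (i.val * j.val) * (-1) ^ (i.val * l.val) := by
    rw [mul_comm i.val, pow_mul, neg_one_pow_val_add, mul_pow, ← pow_mul, ← pow_mul,
      mul_comm j.val, mul_comm l.val]
  have h2 : ((-1 : ℂ) ^ ((i + j).val * l.val)) =
      (-1) ^ (i.val * l.val) * (-1) ^ (j.val * l.val) := by
    rw [pow_mul, neg_one_pow_val_add, mul_pow, ← pow_mul, ← pow_mul]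
  have h3 : ((-1 : ℂ) ^ (j.val * (i + l).val)) =
      (-1) ^ (i.val * j.val) * (-1) ^ (j.val * l.val) := by
    rw [mul_comm j.val, pow_mul, neg_one_pow_val_add, mul_pow, ← pow_mul, ← pow_mul,
      mul_comm l.val]
  rw [h1, h2, h3]
  simp only [mul_sub, sub_mul, mul_smul_comm, smul_mul_assoc, mul_assoc]
  rcases neg_one_pow_eq_or ℂ (i.val * j.val) with h | h <;>
  rcases neg_one_pow_eq_or ℂ (i.val * l.val) with h' | h' <;>
  rcases neg_one_pow_eq_or ℂ (j.val * l.val) with h'' | h'' <;>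
  rw [h, h', h''] <;> module

/-- `[U, W]`: the linear span of the super brackets `[u, w]` with `u ∈ U` and `w ∈ W`. -/
def bracketSpan (U W : Submodule ℂ A) : Submodule ℂ A :=
  Submodule.map₂ (superBracket 𝒜) U W

/-- A Lie sub-superalgebra of a `ℤ/2`-graded associative algebra with its super bracket: a
graded subspace that is closed under the super bracket. -/
structure LieSubsuperalgebra extends Submodule ℂ A where
  proj_mem' : ∀ (i : ZMod 2) {x : A}, x ∈ carrier → GradedAlgebra.proj 𝒜 i x ∈ carrier
  bracket_mem' : ∀ {x y : A}, x ∈ carrier → y ∈ carrier → superBracket 𝒜 x y ∈ carrier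

namespace LieSubsuperalgebra

variable {𝒜}

/-- The super bracket restricted to a Lie sub-superalgebra. -/
def bracket (L : LieSubsuperalgebra 𝒜) (x y : L.toSubmodule) : L.toSubmodule :=
  ⟨superBracket 𝒜 x y, L.bracket_mem' x.2 y.2⟩

/-- The homogeneous part `L_i` of a Lie sub-superalgebra, as a subspace. -/
def part (L : LieSubsuperalgebra 𝒜) (i : ZMod 2) : Submodule ℂ A := L.toSubmodule ⊓ 𝒜 i

/-- The even part `L_0` of a Lie sub-superalgebra. -/
def even (L : LieSubsuperalgebra 𝒜) : LieSubsuperalgebra 𝒜 where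
  toSubmodule := L.part 0
  proj_mem' i x hx := by
    refine ⟨L.proj_mem' i hx.1, ?_⟩
    rw [proj_of_mem 𝒜 hx.2]
    split_ifs
    · exact hx.2
    · exact Submodule.zero_mem _
  bracket_mem' {x y} hx hy := by
    refine ⟨L.bracket_mem' hx.1 hy.1, ?_⟩
    simpa using superBracket_mem 𝒜 hx.2 hy.2

/-- Isomorphism of Lie superalgebras: a linear bijection that preserves the degree and the
super bracket. -/
def Iso {B : Type*} [Ring B] [Algebra ℂ B] {ℬ : ZMod 2 → Submodule ℂ B} [GradedAlgebra ℬ]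
    (L : LieSubsuperalgebra 𝒜) (M : LieSubsuperalgebra ℬ) : Prop :=
  ∃ e : L.toSubmodule ≃ₗ[ℂ] M.toSubmodule,
    (∀ (i : ZMod 2) (x : L.toSubmodule), (x : A) ∈ 𝒜 i → (e x : B) ∈ ℬ i) ∧
    ∀ x y : L.toSubmodule, e (L.bracket x y) = M.bracket (e x) (e y)

/-- `L` is purely even and, with the restriction of the super bracket, isomorphic to the Lie
algebra `𝔩`. -/
def IsoLie (L : LieSubsuperalgebra 𝒜) (𝔩 : Type*) [LieRing 𝔩] [LieAlgebra ℂ 𝔩] : Prop :=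
  L.toSubmodule ≤ 𝒜 0 ∧ ∃ e : L.toSubmodule ≃ₗ[ℂ] 𝔩,
    ∀ x y : L.toSubmodule, e (L.bracket x y) = ⁅e x, e y⁆

end LieSubsuperalgebra

end Super

/-- `U` is the internal direct sum of the subspaces `W 0, …, W (r - 1)`. -/
def IsDirectSum {A : Type*} [AddCommGroup A] [Module ℂ A] {r : ℕ}
    (U : Submodule ℂ A) (W : Fin r → Submodule ℂ A) : Prop :=
  iSupIndep W ∧ ⨆ i, W i = U

/-! ### The Weyl algebra -/

/-- The symplectic form on the span of the generators `p_i` (`Sum.inl i`) and `q_i`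
(`Sum.inr i`): `ω(p_i, q_j) = δ_ij`, `ω(q_i, p_j) = -δ_ij`, and `0` otherwise. -/
def poisson {k : ℕ} : Fin k ⊕ Fin k → Fin k ⊕ Fin k → ℂ
  | Sum.inl i, Sum.inr j => if i = j then 1 else 0
  | Sum.inr i, Sum.inl j => if i = j then -1 else 0
  | _, _ => 0

/-- The defining relations `u v = v u + ω(u, v)` of the Weyl algebra. -/
inductive WeylRel (k : ℕ) :
    FreeAlgebra ℂ (Fin k ⊕ Fin k) → FreeAlgebra ℂ (Fin k ⊕ Fin k) → Prop
  | comm (u v : Fin k ⊕ Fin k) : WeylRel k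
      (FreeAlgebra.ι ℂ u * FreeAlgebra.ι ℂ v)
      (FreeAlgebra.ι ℂ v * FreeAlgebra.ι ℂ u + algebraMap ℂ _ (poisson u v))

/-- The Weyl algebra `W_{2k}`, generated by `p_1, q_1, …, p_k, q_k`. -/
def Weyl (k : ℕ) : Type := RingQuot (WeylRel k)

instance (k : ℕ) : Ring (Weyl k) := inferInstanceAs (Ring (RingQuot (WeylRel k)))

instance (k : ℕ) : Algebra ℂ (Weyl k) := inferInstanceAs (Algebra ℂ (RingQuot (WeylRel k)))

namespace Weyl

variable {k : ℕ}

/-- The quotient map from the free algebra. -/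
def mk (k : ℕ) : FreeAlgebra ℂ (Fin k ⊕ Fin k) →ₐ[ℂ] Weyl k := RingQuot.mkAlgHom ℂ (WeylRel k)

/-- The generators: `gen (Sum.inl i) = p_i` and `gen (Sum.inr i) = q_i`. -/
def gen (u : Fin k ⊕ Fin k) : Weyl k := mk k (FreeAlgebra.ι ℂ u)

lemma gen_mul_gen (u v : Fin k ⊕ Fin k) :
    gen u * gen v = gen v * gen u + algebraMap ℂ (Weyl k) (poisson u v) := by
  have h : mk k _ = mk k _ := RingQuot.mkAlgHom_rel ℂ (WeylRel.comm u v)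
  rw [map_mul, map_add, map_mul, AlgHom.commutes] at h
  exact h

/-- The universal property of the Weyl algebra. -/
def lift {B : Type*} [Ring B] [Algebra ℂ B] (f : Fin k ⊕ Fin k → B)
    (hf : ∀ u v, f u * f v = f v * f u + algebraMap ℂ B (poisson u v)) : Weyl k →ₐ[ℂ] B :=
  RingQuot.liftAlgHom ℂ ⟨FreeAlgebra.lift ℂ f, by
    rintro _ _ ⟨u, v⟩
    simpa using hf u v⟩

@[simp] lemma lift_gen {B : Type*} [Ring B] [Algebra ℂ B] (f : Fin k ⊕ Fin k → B)
    (hf : ∀ u v, f u * f v = f v * f u + algebraMap ℂ B (poisson u v)) (u : Fin k ⊕ Fin k) :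
    lift f hf (gen u) = f u := by
  have h := RingQuot.liftAlgHom_mkAlgHom_apply ℂ (FreeAlgebra.lift ℂ f) (s := WeylRel k) (by
    rintro _ _ ⟨u, v⟩
    simpa using hf u v) (FreeAlgebra.ι ℂ u)
  rw [FreeAlgebra.lift_ι_apply] at h
  exact h

lemma algHom_ext {B : Type*} [Ring B] [Algebra ℂ B] {f g : Weyl k →ₐ[ℂ] B}
    (h : ∀ u, f (gen u) = g (gen u)) : f = g := by
  apply RingQuot.ringQuot_ext' ℂ (s := WeylRel k)
  apply FreeAlgebra.hom_ext
  funext u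
  exact h u

/-- The parity automorphism of the Weyl algebra, `p_i ↦ -p_i`, `q_i ↦ -q_i`. -/
def parity (k : ℕ) : Weyl k →ₐ[ℂ] Weyl k :=
  lift (fun u => -gen u) (by
    intro u v
    rw [neg_mul_neg, neg_mul_neg]
    exact gen_mul_gen u v)

@[simp] lemma parity_gen (u : Fin k ⊕ Fin k) : parity k (gen u) = -gen u := by
  simp [parity]

lemma parity_parity (a : Weyl k) : parity k (parity k a) = a := by
  have h : (parity k).comp (parity k) = AlgHom.id ℂ _ := algHom_ext (by simp)
  exact DFunLike.congr_fun h a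

/-- The `ℤ/2`-grading of the Weyl algebra in which all `p_i` and `q_i` have degree `1`. -/
def grading (k : ℕ) : ZMod 2 → Submodule ℂ (Weyl k) := parityGrading (parity k)

instance : GradedAlgebra (grading k) := parityGradedAlgebra (parity k) parity_parity

lemma mem_grading (i : ZMod 2) (a : Weyl k) :
    a ∈ grading k i ↔ parity k a = ((-1 : ℂ) ^ i.val) • a := mem_parityGrading _ _ _

end Weyl

/-! ### The Clifford algebra and the Clifford–Weyl algebra -/

/-- The quadratic form `x_1² + ⋯ + x_n²` on `ℂⁿ`. -/
abbrev sumSq (n : ℕ) : QuadraticForm ℂ (Fin n → ℂ) :=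
  QuadraticMap.weightedSumSquares ℂ fun _ : Fin n => (1 : ℂ)

/-- The Clifford algebra `C(n)`: generated by the basis `ω_1, …, ω_n` of `ℂⁿ` with
`ω_i² = 1` and `ω_i ω_j = -ω_j ω_i` for `i ≠ j`. -/
abbrev Cliff (n : ℕ) : Type := CliffordAlgebra (sumSq n)

/-- The `ℤ/2`-grading of `C(n)` in which all `ω_i` have degree `1`. -/
abbrev cliffGrading (n : ℕ) : ZMod 2 → Submodule ℂ (Cliff n) := CliffordAlgebra.evenOdd (sumSq n)

/-- The Clifford–Weyl algebra `C(n, 2k) = C(n) ⊗_{ℤ/2} W_{2k}`: the graded tensor product for the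
gradings in which all of `ω_i`, `p_i`, `q_i` have degree `1`, so that the `ω_i` anticommute with
the `p_j` and the `q_j`. -/
abbrev CW (n k : ℕ) : Type := GradedTensorProduct ℂ (cliffGrading n) (Weyl.grading k)

namespace CW

variable (n k : ℕ)

/-- The embedding of the Clifford algebra, `a ↦ a ⊗ 1`. -/
abbrev inclCliff : Cliff n →ₐ[ℂ] CW n k :=
  GradedTensorProduct.includeLeft (cliffGrading n) (Weyl.grading k)

/-- The embedding of the Weyl algebra, `b ↦ 1 ⊗ b`. -/
abbrev inclWeyl : Weyl k →ₐ[ℂ] CW n k :=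
  GradedTensorProduct.includeRight (cliffGrading n) (Weyl.grading k)

/-- The automorphism `a ⊗ b ↦ a ⊗ parity(b)`: it fixes the `ω_i` and changes the sign of the `p_i`
and the `q_i`. -/
def parity : CW n k →ₐ[ℂ] CW n k :=
  GradedTensorProduct.lift (cliffGrading n) (Weyl.grading k)
    (inclCliff n k) ((inclWeyl n k).comp (Weyl.parity k)) (by
      intro i j a b
      have hb : Weyl.parity k (b : Weyl k) = ((-1 : ℂ) ^ j.val) • (b : Weyl k) :=
        (Weyl.mem_grading j _).mp b.2
      have h := GradedTensorProduct.tmul_coe_mul_coe_tmul (R := ℂ) (cliffGrading n)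
        (Weyl.grading k) 1 b a 1
      simp only [one_mul, mul_one] at h
      simp only [AlgHom.comp_apply, hb, map_smul, mul_smul_comm, smul_mul_assoc]
      rw [smul_comm]
      congr 1
      simp only [GradedTensorProduct.includeLeft_apply, GradedTensorProduct.includeRight_apply]
      rw [h, GradedTensorProduct.tmul_one_mul_one_tmul, smul_smul, Int.units_mul_self, one_smul])

lemma parity_tmul (a : Cliff n) (b : Weyl k) :
    parity n k (a ᵍ⊗ₜ[ℂ] b : CW n k) = (a ᵍ⊗ₜ[ℂ] (Weyl.parity k b) : CW n k) := by
  simp only [parity, GradedTensorProduct.lift_tmul, AlgHom.comp_apply,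
    GradedTensorProduct.includeLeft_apply, GradedTensorProduct.includeRight_apply]
  exact GradedTensorProduct.tmul_one_mul_one_tmul _ _ _ _

lemma parity_parity (x : CW n k) : parity n k (parity n k x) = x := by
  have h : (parity n k).comp (parity n k) = AlgHom.id ℂ _ := by
    apply GradedTensorProduct.algHom_ext
    · ext a
      simp [parity_tmul]
    · apply Weyl.algHom_ext
      intro u
      simp [parity_tmul]
  exact DFunLike.congr_fun h x

/-- The grading `Δ₂` of the Clifford–Weyl algebra: the `ω_i` have degree `0`, the `p_i` and the
`q_i` have degree `1`. -/
def grading : ZMod 2 → Submodule ℂ (CW n k) := parityGrading (parity n k)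

instance : GradedAlgebra (grading n k) := parityGradedAlgebra (parity n k) (parity_parity n k)

lemma tmul_mem_grading (a : Cliff n) {i : ZMod 2} {b : Weyl k} (hb : b ∈ Weyl.grading k i) :
    (a ᵍ⊗ₜ[ℂ] b : CW n k) ∈ grading n k i := by
  rw [grading, mem_parityGrading, parity_tmul, (Weyl.mem_grading i b).mp hb]
  exact TensorProduct.tmul_smul _ _ _

/-- `V_0`, the span of `ω_1, …, ω_n`. -/
def V0 : Submodule ℂ (CW n k) :=
  Submodule.span ℂ (Set.range fun i : Fin n =>
    inclCliff n k (CliffordAlgebra.ι (sumSq n) (Pi.single i 1)))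

/-- `V_1`, the span of `p_1, q_1, …, p_k, q_k`. -/
def V1 : Submodule ℂ (CW n k) :=
  Submodule.span ℂ (Set.range fun u : Fin k ⊕ Fin k => inclWeyl n k (Weyl.gen u))

/-- `V = V_0 + V_1`. -/
def V : Submodule ℂ (CW n k) := V0 n k ⊔ V1 n k

variable {n k} in
/-- `[U, W]` in the Clifford–Weyl algebra, for the super bracket of the grading `Δ₂`. -/
abbrev br (U W : Submodule ℂ (CW n k)) : Submodule ℂ (CW n k) := bracketSpan (grading n k) U W

end CW

/-! ### The orthosymplectic Lie superalgebra -/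

namespace Osp

variable (m k : ℕ)

/-- The index set of the standard basis of `ℂ^(m|2k)`. -/
abbrev Idx : Type := Fin m ⊕ (Fin k ⊕ Fin k)

/-- Matrices of `gl(m|2k)`. -/
abbrev Mat : Type := Matrix (Idx m k) (Idx m k) ℂ

variable {m k} in
/-- The degree of a basis vector: the first `m` are even, the last `2k` are odd. -/
def deg : Idx m k → ZMod 2 := Sum.elim (fun _ => 0) (fun _ => 1)

/-- The `ℤ/2`-grading of `gl(m|2k)`: a matrix has degree `s` if its only nonzero entries are at
places `(u, v)` with `deg u + deg v = s`, that is, if it maps vectors of degree `t` to vectors of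
degree `s + t`. -/
def glGrading (s : ZMod 2) : Submodule ℂ (Mat m k) where
  carrier := {X | ∀ u v, deg u + deg v ≠ s → X u v = 0}
  add_mem' := by
    intro X Y hX hY u v h
    simp [hX u v h, hY u v h]
  zero_mem' := by intro u v _; rfl
  smul_mem' := by
    intro c X hX u v h
    simp [hX u v h]

instance : SetLike.GradedMonoid (glGrading m k) where
  one_mem := by
    intro u v h
    refine Matrix.one_apply_ne fun huv => h ?_
    subst huv
    exact CharTwo.add_self_eq_zero _
  mul_mem s t X Y hX hY := by
    intro u v h
    rw [Matrix.mul_apply]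
    refine Finset.sum_eq_zero fun w _ => ?_
    by_cases h1 : deg u + deg w = s
    · by_cases h2 : deg w + deg v = t
      · refine absurd ?_ h
        rw [← h1, ← h2, add_assoc, ← add_assoc (deg w), CharTwo.add_self_eq_zero, zero_add]
      · rw [hY w v h2, mul_zero]
    · rw [hX u w h1, zero_mul]

instance : GradedAlgebra (glGrading m k) :=
  gradedAlgebraOfSplit (glGrading m k)
    (by
      rw [Submodule.disjoint_def]
      intro X h0 h1
      ext u v
      by_cases h : deg u + deg v = 0
      · exact h1 u v (by rw [h]; decide)
      · exact h0 u v h)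
    (by
      rw [eq_top_iff]
      intro X _
      have hX : X = Matrix.of (fun u v => if deg u + deg v = 0 then X u v else 0) +
          Matrix.of (fun u v => if deg u + deg v = 0 then 0 else X u v) := by
        ext u v
        by_cases h : deg u + deg v = 0 <;> simp [h]
      rw [hX]
      refine Submodule.add_mem_sup ?_ ?_
      · intro u v h
        simp [h]
      · intro u v h
        have h2 : ∀ y : ZMod 2, y ≠ 1 → y = 0 := by decide
        simp [h2 _ h])

/-- The Gram matrix of the standard nondegenerate even supersymmetric bilinear form `F` on
`ℂ^(m|2k)`: the identity on the even part, the standard symplectic form on the odd part, and the two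
parts are orthogonal. -/
def form : Mat m k := Matrix.fromBlocks 1 0 0 (Matrix.J (Fin k) ℂ)

/-- The diagonal matrix with entries `(-1)^(s * deg u)`. -/
def signMat (s : ZMod 2) : Mat m k := Matrix.diagonal fun u => (-1 : ℂ) ^ (s.val * (deg u).val)

variable {m k} in
/-- For `X` of degree `s`: `F(X e_u, e_v) = -(-1)^(s * deg u) F(e_u, X e_v)` for all basis vectors
`e_u`, `e_v`. -/
def PreservesForm (s : ZMod 2) (X : Mat m k) : Prop :=
  Matrix.transpose X * form m k = -(signMat m k s * form m k * X)

variable {m k} in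
lemma PreservesForm.add {s : ZMod 2} {X Y : Mat m k} (hX : PreservesForm s X)
    (hY : PreservesForm s Y) : PreservesForm s (X + Y) := by
  unfold PreservesForm at *
  rw [Matrix.transpose_add, Matrix.add_mul, hX, hY, Matrix.mul_add, neg_add]

variable {m k} in
lemma signMat_mul_form (s : ZMod 2) : signMat m k s * form m k = form m k * signMat m k s := by
  ext u v
  rw [signMat, Matrix.diagonal_mul, Matrix.mul_diagonal, mul_comm]
  by_cases h : deg u = deg v
  · rw [h]
  · have h0 : form m k u v = 0 := by
      rcases u with u | u <;> rcases v with v | v <;> simp_all [deg, form]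
    simp [h0]

variable {m k} in
lemma signMat_mul_signMat (s t : ZMod 2) :
    signMat m k s * signMat m k t = signMat m k (s + t) := by
  rw [signMat, signMat, signMat, Matrix.diagonal_mul_diagonal]
  congr 1
  funext u
  rw [pow_mul, pow_mul, pow_mul, neg_one_pow_val_add, mul_pow]

variable {m k} in
lemma signMat_mul_of_mem (s : ZMod 2) {t : ZMod 2} {X : Mat m k} (hX : X ∈ glGrading m k t) :
    signMat m k s * X = ((-1 : ℂ) ^ (s.val * t.val)) • (X * signMat m k s) := by
  ext u v
  rw [signMat, Matrix.smul_apply, Matrix.diagonal_mul, Matrix.mul_diagonal]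
  by_cases h : deg u + deg v = t
  · have hu : deg u = t + deg v := by
      rw [← h, add_assoc, CharTwo.add_self_eq_zero, add_zero]
    rw [hu, mul_comm s.val, mul_comm s.val, mul_comm s.val, pow_mul, pow_mul, pow_mul,
      neg_one_pow_val_add, mul_pow, smul_eq_mul]
    ring
  · rw [hX u v h]
    simp

variable {m k} in
lemma preservesForm_bracket {s t : ZMod 2} {X Y : Mat m k} (hXs : X ∈ glGrading m k s)
    (hYt : Y ∈ glGrading m k t) (hX : PreservesForm s X) (hY : PreservesForm t Y) :
    PreservesForm (s + t) (superBracket (glGrading m k) X Y) := by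
  have aux : ∀ {s t : ZMod 2} {X Y : Mat m k}, Y ∈ glGrading m k t → PreservesForm s X →
      PreservesForm t Y → Matrix.transpose (X * Y) * form m k =
        ((-1 : ℂ) ^ (s.val * t.val)) • (signMat m k (s + t) * form m k * (Y * X)) := by
    intro s t X Y hYt hX hY
    have hc : Matrix.transpose Y * signMat m k s =
        ((-1 : ℂ) ^ (s.val * t.val)) • (signMat m k s * Matrix.transpose Y) := by
      have h := congrArg Matrix.transpose (signMat_mul_of_mem s hYt)
      rw [Matrix.transpose_mul, Matrix.transpose_smul, Matrix.transpose_mul] at h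
      simpa [signMat] using h
    have hX' : Matrix.transpose X * form m k = -(signMat m k s * form m k * X) := hX
    have hY' : Matrix.transpose Y * form m k = -(signMat m k t * form m k * Y) := hY
    calc Matrix.transpose (X * Y) * form m k
        = -((Matrix.transpose Y * signMat m k s) * (form m k * X)) := by
          rw [Matrix.transpose_mul, Matrix.mul_assoc, hX', Matrix.mul_neg, Matrix.mul_assoc,
            Matrix.mul_assoc]
      _ = -(((-1 : ℂ) ^ (s.val * t.val)) •
            (signMat m k s * ((Matrix.transpose Y * form m k) * X))) := by
          rw [hc, Matrix.smul_mul, Matrix.mul_assoc, Matrix.mul_assoc]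
      _ = _ := by
          rw [hY', Matrix.neg_mul, Matrix.mul_neg, smul_neg, neg_neg, ← signMat_mul_signMat]
          simp only [Matrix.mul_assoc]
  have hsq : ((-1 : ℂ) ^ (s.val * t.val)) * (-1 : ℂ) ^ (s.val * t.val) = 1 := by
    rw [← mul_pow]; simp
  unfold PreservesForm
  rw [superBracket_of_mem _ hXs hYt, Matrix.transpose_sub, Matrix.sub_mul, Matrix.transpose_smul,
    Matrix.smul_mul, aux hYt hX hY, aux hXs hY hX, smul_smul, mul_comm t.val, hsq, one_smul,
    add_comm t s, Matrix.mul_sub, Matrix.mul_smul, neg_sub]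

/-- The orthosymplectic Lie superalgebra `osp(m, 2k)`: the matrices of `gl(m|2k)` whose homogeneous
components preserve the form `F`. -/
def osp : LieSubsuperalgebra (glGrading m k) where
  carrier := {X | ∀ s, PreservesForm s (GradedAlgebra.proj (glGrading m k) s X)}
  add_mem' := by
    intro X Y hX hY s
    rw [map_add]
    exact (hX s).add (hY s)
  zero_mem' := by
    intro s
    simp [PreservesForm]
  smul_mem' := by
    intro c X hX s
    have h1 := hX s
    unfold PreservesForm at *
    rw [map_smul, Matrix.transpose_smul, Matrix.smul_mul, h1, Matrix.mul_smul, smul_neg]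
  proj_mem' := by
    intro s X hX t
    by_cases h : t = s
    · subst h
      rw [proj_of_mem _ (proj_mem _ t X), if_pos rfl]
      exact hX t
    · rw [proj_of_mem _ (proj_mem _ s X), if_neg h]
      simp [PreservesForm]
  bracket_mem' := by
    intro X Y hX hY
    have key : ∀ (s t r : ZMod 2), PreservesForm r (GradedAlgebra.proj (glGrading m k) r
        (superBracket (glGrading m k) (GradedAlgebra.proj (glGrading m k) s X)
          (GradedAlgebra.proj (glGrading m k) t Y))) := by
      intro s t r
      rw [proj_of_mem _ (superBracket_mem _ (proj_mem _ s X) (proj_mem _ t Y))]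
      split_ifs with h
      · subst h
        exact preservesForm_bracket (proj_mem _ s X) (proj_mem _ t Y) (hX s) (hY t)
      · simp [PreservesForm]
    intro r
    have hXs : X = GradedAlgebra.proj (glGrading m k) 0 X + GradedAlgebra.proj (glGrading m k) 1 X :=
      eq_proj_add_proj _ X
    have hYs : Y = GradedAlgebra.proj (glGrading m k) 0 Y + GradedAlgebra.proj (glGrading m k) 1 Y :=
      eq_proj_add_proj _ Y
    rw [hXs, hYs]
    simp only [map_add, LinearMap.add_apply]
    exact ((key 0 0 r).add (key 1 0 r)).add ((key 0 1 r).add (key 1 1 r))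

end Osp

end CliffordWeyl

end

/-!
# Palev's theorem for Clifford–Weyl algebras

After a rescaling, the generators `e a` of the Clifford–Weyl algebra `C(n, 2k)`, indexed by the basis
of `ℂ^(n|2k)`, satisfy `e a * e b + (-1)^(deg a * deg b) e b * e a = 2 form a b`, where `form` is
the supersymmetric form that defines `osp(n, 2k)`. For such generators the super-antisymmetric
quadratic expressions `∑ x a b • e a * e b` close under the super bracket and multiply like the
matrices `x * form`; and `X ∈ osp(n, 2k)` means exactly that `X = x * form` with `x`
super-antisymmetric (`mul_form_mem_osp`). This realizes `osp(n, 2k)` on `[V, V]`.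

The computation of the bracket only uses products of pairs of generators, through the relations
collected in `IsPairSymbol` (`IsPairSymbol.bracket_quad`, `IsPairSymbol.spin_bracket`). One more even
generator `e zero` can therefore be adjoined virtually, by letting `i e b` play the role of
`e zero * e b` (`pairs`, `IsGenerators.isPairSymbol`): the linear expressions in the generators become
quadratic, and `V + [V, V]` is the image of `osp(n + 1, 2k)`.

The realization is injective (`IsGenerators.nondegenerate_pairs`). The automorphism `e a ↦ -e a`
separates linear from quadratic expressions; a linear expression is recovered from its
(anti)commutators with the generators, which are scalars, and a quadratic one from its brackets with
the generators, which are linear. All that is needed is that `1 ≠ 0` in the Clifford–Weyl algebra,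
which follows from the action of the Weyl algebra on polynomials (`Weyl.polynomialRep`).

Every subspace in the theorem is the image of the super-antisymmetric matrices with support in a
certain set of pairs of indices (`block`), so that directness of the sums is disjointness of these sets
(`IsPairSymbol.isDirectSum_block`), and the isomorphisms with the smaller algebras come from
restriction to a subset of the basis or to block diagonal matrices.
-/

noncomputable section

namespace CliffordWeyl

namespace Osp

variable {m k : ℕ}

/-! ### Super-antisymmetric matrices and the orthosymplectic Lie superalgebra -/

/-- The sign `(-1)^(deg a * deg b)` of the exchange of two basis vectors. -/
def sgn (a b : Idx m k) : ℂ := (-1) ^ ((deg a).val * (deg b).val)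

lemma deg_eq_zero_or_one (a : Idx m k) : deg a = 0 ∨ deg a = 1 := by
  rcases a with a | a
  · exact Or.inl rfl
  · exact Or.inr rfl

lemma sgn_comm (a b : Idx m k) : sgn a b = sgn b a := by
  rw [sgn, sgn, mul_comm]

lemma sgn_mul_self (a b : Idx m k) : sgn a b * sgn a b = 1 := by
  rw [sgn, ← mul_pow]; simp

lemma neg_one_pow_deg_add (a b c d : Idx m k) :
    (-1 : ℂ) ^ ((deg a + deg b).val * (deg c + deg d).val) =
      sgn a c * sgn a d * sgn b c * sgn b d := by
  rcases deg_eq_zero_or_one a with ha | ha <;> rcases deg_eq_zero_or_one b with hb | hb <;>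
  rcases deg_eq_zero_or_one c with hc | hc <;> rcases deg_eq_zero_or_one d with hd | hd <;>
  simp [sgn, ha, hb, hc, hd, ZMod.val_one, CharTwo.add_self_eq_zero]

lemma neg_one_pow_deg_add_mul (a b c : Idx m k) :
    (-1 : ℂ) ^ ((deg a + deg b).val * (deg c).val) = sgn a c * sgn b c := by
  rcases deg_eq_zero_or_one a with ha | ha <;> rcases deg_eq_zero_or_one b with hb | hb <;>
  rcases deg_eq_zero_or_one c with hc | hc <;>
  simp [sgn, ha, hb, hc, ZMod.val_one, CharTwo.add_self_eq_zero]

lemma deg_eq_of_form_ne_zero {a b : Idx m k} (h : form m k a b ≠ 0) : deg a = deg b := by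
  rcases a with a | a <;> rcases b with b | b <;> simp_all [deg, form]

/-- The form is supersymmetric. -/
lemma form_swap (a b : Idx m k) : form m k a b = sgn a b * form m k b a := by
  rcases a with a | a | a <;> rcases b with b | b | b <;>
    simp [form, sgn, deg, Matrix.J, Matrix.one_apply, ZMod.val_one, eq_comm] <;>
    split_ifs <;> simp

variable (m k) in
/-- The inverse of the Gram matrix `form`. -/
def formInv : Mat m k := Matrix.fromBlocks 1 0 0 (-Matrix.J (Fin k) ℂ)

lemma form_mul_formInv : form m k * formInv m k = 1 := by
  simp [form, formInv, Matrix.fromBlocks_multiply, Matrix.J_squared]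

lemma formInv_mul_form : formInv m k * form m k = 1 :=
  mul_eq_one_comm.mp form_mul_formInv

lemma form_mem_zero : form m k ∈ glGrading m k 0 := by
  intro a b h
  by_contra h0
  exact h (by rw [deg_eq_of_form_ne_zero h0, CharTwo.add_self_eq_zero])

lemma formInv_mem_zero : formInv m k ∈ glGrading m k 0 := by
  intro a b h
  rcases a with a | a <;> rcases b with b | b <;> simp_all [deg, formInv]
  exact absurd (CharTwo.add_self_eq_zero _) h

lemma mul_form_mem {s : ZMod 2} {x : Mat m k} (hx : x ∈ glGrading m k s) :
    x * form m k ∈ glGrading m k s := by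
  simpa using SetLike.mul_mem_graded hx form_mem_zero

lemma mul_formInv_mem {s : ZMod 2} {x : Mat m k} (hx : x ∈ glGrading m k s) :
    x * formInv m k ∈ glGrading m k s := by
  simpa using SetLike.mul_mem_graded hx formInv_mem_zero

lemma proj_mul_form (s : ZMod 2) (x : Mat m k) :
    GradedAlgebra.proj (glGrading m k) s (x * form m k) =
      GradedAlgebra.proj (glGrading m k) s x * form m k := by
  have hx := eq_proj_add_proj (glGrading m k) x
  conv_lhs => rw [hx, Matrix.add_mul, map_add,
    proj_of_mem _ (mul_form_mem (proj_mem (glGrading m k) 0 x)),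
    proj_of_mem _ (mul_form_mem (proj_mem (glGrading m k) 1 x))]
  have h2 : ∀ y : ZMod 2, y = 0 ∨ y = 1 := by decide
  rcases h2 s with rfl | rfl <;> simp

lemma proj_apply (s : ZMod 2) (x : Mat m k) (a b : Idx m k) :
    GradedAlgebra.proj (glGrading m k) s x a b = if deg a + deg b = s then x a b else 0 := by
  have hx := congrFun (congrFun (eq_proj_add_proj (glGrading m k) x) a) b
  split_ifs with h
  · have h2 : ∀ y : ZMod 2, y = 0 ∨ y = 1 := by decide
    rw [hx, Matrix.add_apply]
    rcases h2 s with rfl | rfl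
    · rw [proj_mem (glGrading m k) 1 x a b (by rw [h]; decide), add_zero]
    · rw [proj_mem (glGrading m k) 0 x a b (by rw [h]; decide), zero_add]
  · exact proj_mem (glGrading m k) s x a b h

variable (m k) in
/-- The space of super-antisymmetric matrices, `x a b = -(-1)^(deg a * deg b) x b a`: the second
super exterior power of `ℂ^(m|2k)`. -/
def superAnti : Submodule ℂ (Mat m k) where
  carrier := {x | ∀ a b, x a b = -(sgn a b * x b a)}
  add_mem' := by
    intro x y hx hy a b
    rw [Matrix.add_apply, Matrix.add_apply, hx a b, hy a b]
    ring
  zero_mem' := by intro a b; simp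
  smul_mem' := by
    intro c x hx a b
    rw [Matrix.smul_apply, Matrix.smul_apply, hx a b, smul_eq_mul, smul_eq_mul]
    ring

lemma form_transpose : (form m k).transpose = form m k * signMat m k 1 := by
  ext a b
  rw [Matrix.transpose_apply, signMat, Matrix.mul_diagonal, form_swap]
  by_cases h : form m k a b = 0
  · simp [h]
  · rw [sgn, deg_eq_of_form_ne_zero h, mul_comm, ZMod.val_one, one_mul]
    rcases deg_eq_zero_or_one b with hb | hb <;> simp [hb, ZMod.val_one]

/-- For a homogeneous matrix `x`, the endomorphism `x * form` preserves the form exactly if `x` is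
super-antisymmetric. -/
lemma preservesForm_mul_form {s : ZMod 2} {x : Mat m k} (hx : x ∈ glGrading m k s) :
    PreservesForm s (x * form m k) ↔ x ∈ superAnti m k := by
  have h1 : (x * form m k).transpose * form m k =
      form m k * (signMat m k 1 * x.transpose) * form m k := by
    rw [Matrix.transpose_mul, form_transpose]
    simp only [Matrix.mul_assoc]
  have h2 : -(signMat m k s * form m k * (x * form m k)) =
      form m k * (-(signMat m k s * x)) * form m k := by
    rw [signMat_mul_form]
    simp only [Matrix.mul_assoc, Matrix.mul_neg, Matrix.neg_mul]
  have hcancel : ∀ {y z : Mat m k}, form m k * y * form m k = form m k * z * form m k → y = z := by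
    intro y z h
    have h' := congrArg (fun w => formInv m k * w * formInv m k) h
    simpa only [Matrix.mul_assoc, form_mul_formInv, Matrix.mul_one, ← Matrix.mul_assoc (formInv m k),
      formInv_mul_form, Matrix.one_mul] using h'
  have h3 : PreservesForm s (x * form m k) ↔
      signMat m k 1 * x.transpose = -(signMat m k s * x) := by
    unfold PreservesForm
    rw [h1, h2]
    exact ⟨fun h => hcancel h, fun h => by rw [h]⟩
  rw [h3]
  have key : ∀ a b, (signMat m k 1 * x.transpose) a b = (-(signMat m k s * x)) a b ↔
      x b a = -(sgn b a * x a b) := by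
    intro a b
    rw [Matrix.neg_apply, signMat, signMat, Matrix.diagonal_mul, Matrix.diagonal_mul,
      Matrix.transpose_apply]
    by_cases h : deg a + deg b = s
    · subst h
      rcases deg_eq_zero_or_one a with ha | ha <;> rcases deg_eq_zero_or_one b with hb | hb <;>
        simp [sgn, ha, hb, ZMod.val_one, CharTwo.add_self_eq_zero, neg_eq_iff_eq_neg]
    · rw [hx a b h, hx b a (by rwa [add_comm])]
      simp
  constructor
  · intro h a b
    exact (key b a).mp (by rw [h])
  · intro h
    ext a b
    exact (key a b).mpr (h b a)

lemma proj_mem_superAnti {x : Mat m k} (hx : x ∈ superAnti m k) (s : ZMod 2) :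
    GradedAlgebra.proj (glGrading m k) s x ∈ superAnti m k := by
  intro a b
  rw [proj_apply, proj_apply, add_comm (deg b)]
  split_ifs
  · exact hx a b
  · simp

/-- `osp(m, 2k)` is the space of super-antisymmetric matrices, multiplied by the Gram matrix. -/
lemma mul_form_mem_osp (x : Mat m k) :
    x * form m k ∈ (osp m k).toSubmodule ↔ x ∈ superAnti m k := by
  have h : x * form m k ∈ (osp m k).toSubmodule ↔
      ∀ s, PreservesForm s (GradedAlgebra.proj (glGrading m k) s (x * form m k)) := Iff.rfl
  rw [h]
  constructor
  · intro h
    rw [eq_proj_add_proj (glGrading m k) x]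
    refine Submodule.add_mem _ ?_ ?_
    · rw [← preservesForm_mul_form (proj_mem _ _ _), ← proj_mul_form]
      exact h 0
    · rw [← preservesForm_mul_form (proj_mem _ _ _), ← proj_mul_form]
      exact h 1
  · intro hx s
    rw [proj_mul_form, preservesForm_mul_form (proj_mem _ _ _)]
    exact proj_mem_superAnti hx s

lemma mul_formInv_mem_superAnti {X : Mat m k} (hX : X ∈ (osp m k).toSubmodule) :
    X * formInv m k ∈ superAnti m k := by
  rw [← mul_form_mem_osp, Matrix.mul_assoc, formInv_mul_form, Matrix.mul_one]
  exact hX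

/-! ### Families with the relations of products of pairs of generators -/

section PairSymbol

variable {A : Type*} [Ring A] [Algebra ℂ A] (𝒜 : ZMod 2 → Submodule ℂ A) [GradedAlgebra 𝒜]

/-- A family `T a b` that has the properties of the products `e a * e b`, where `e` is a family with
`e a * e b + (-1)^(deg a * deg b) e b * e a = 2 form a b`. The factors `e a` themselves need not
lie in the algebra. -/
structure IsPairSymbol (T : Idx m k → Idx m k → A) : Prop where
  mem : ∀ a b, T a b ∈ 𝒜 (deg a + deg b)
  swap : ∀ a b, T a b = (2 * form m k a b) • (1 : A) - sgn a b • T b a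
  contract : ∀ a b c d, T a b * T c d =
    (2 * form m k b c) • T a d - sgn b c • (T a c * T b d)

/-- The quadratic expression `∑ x a b • T a b`. -/
def quad (T : Idx m k → Idx m k → A) : Mat m k →ₗ[ℂ] A where
  toFun x := ∑ a, ∑ b, x a b • T a b
  map_add' x y := by simp only [Matrix.add_apply, add_smul, Finset.sum_add_distrib]
  map_smul' c x := by
    simp only [Matrix.smul_apply, smul_eq_mul, mul_smul, Finset.smul_sum, RingHom.id_apply]

lemma quad_apply (T : Idx m k → Idx m k → A) (x : Mat m k) :
    quad T x = ∑ a, ∑ b, x a b • T a b := rfl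

lemma quad_mul_form_mul (T : Idx m k → Idx m k → A) (x y : Mat m k) :
    quad T (x * form m k * y) =
      ∑ a, ∑ b, ∑ c, ∑ d, (x a b * form m k b c * y c d) • T a d := by
  rw [quad_apply]
  refine Finset.sum_congr rfl fun a _ => ?_
  simp only [Matrix.mul_apply, Finset.sum_mul, Finset.sum_smul]
  rw [Finset.sum_comm]
  conv_rhs => rw [Finset.sum_comm]
  refine Finset.sum_congr rfl fun c _ => ?_
  exact Finset.sum_comm

lemma sum_four_rotate {ι M : Type*} [Fintype ι] [AddCommMonoid M] (F : ι → ι → ι → ι → M) :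
    ∑ a, ∑ b, ∑ c, ∑ d, F a b c d = ∑ c, ∑ d, ∑ a, ∑ b, F a b c d := by
  have h := Finset.sum_comm (s := (Finset.univ : Finset (ι × ι)))
    (t := (Finset.univ : Finset (ι × ι))) (f := fun p q => F p.1 p.2 q.1 q.2)
  simpa only [Fintype.sum_prod_type] using h

variable {𝒜}

/-- The two middle factors, then the outer ones, are exchanged until `T a b * T c d` has become
`T c d * T a b`; each exchange leaves a term with the form. -/
lemma IsPairSymbol.bracket {T : Idx m k → Idx m k → A} (hT : IsPairSymbol 𝒜 T)
    (a b c d : Idx m k) :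
    superBracket 𝒜 (T a b) (T c d) =
      (2 * form m k b c) • T a d - (2 * sgn b c * form m k b d) • T a c +
      (2 * sgn b c * sgn b d * form m k a c) • T d b -
      (2 * sgn b c * sgn b d * sgn a c * form m k a d) • T c b := by
  rw [superBracket_of_mem 𝒜 (hT.mem a b) (hT.mem c d), neg_one_pow_deg_add]
  have h2 : T a c * T b d = (2 * form m k b d) • T a c - sgn b d • (T a c * T d b) := by
    conv_lhs => rw [hT.swap b d]
    rw [mul_sub, mul_smul_comm, mul_one, mul_smul_comm]
  have h3 : T a c * T d b = (2 * form m k a c) • T d b - sgn a c • (T c a * T d b) := by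
    conv_lhs => rw [hT.swap a c]
    rw [sub_mul, smul_mul_assoc, one_mul, smul_mul_assoc]
  rw [hT.contract a b c d, h2, h3, hT.contract c a d b]
  module

/-- The super bracket of two quadratic expressions is again quadratic: `4⁻¹ • quad T x` behaves like
the matrix `x * form`. -/
lemma IsPairSymbol.bracket_quad {T : Idx m k → Idx m k → A} (hT : IsPairSymbol 𝒜 T)
    {i j : ZMod 2} {x y : Mat m k} (hxi : x ∈ glGrading m k i) (hyj : y ∈ glGrading m k j)
    (hy : y ∈ superAnti m k) :
    superBracket 𝒜 (quad T x) (quad T y) =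
      (4 : ℂ) • quad T (x * form m k * y) -
        (4 * (-1 : ℂ) ^ (i.val * j.val)) • quad T (y * form m k * x) := by
  have hlhs : superBracket 𝒜 (quad T x) (quad T y) =
      ∑ a, ∑ b, ∑ c, ∑ d, (x a b * y c d) • superBracket 𝒜 (T a b) (T c d) := by
    simp only [quad_apply, map_sum, LinearMap.sum_apply, map_smul, LinearMap.smul_apply,
      Finset.smul_sum, smul_smul]
    rw [sum_four_rotate]
    simp only [mul_comm (y _ _)]
  -- The four terms of `IsPairSymbol.bracket` contribute equally in pairs, since `y` is
  -- super-antisymmetric and the form is supersymmetric.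
  have h1 : ∑ a, ∑ b, ∑ c, ∑ d, (x a b * y c d * (2 * form m k b c)) • T a d =
      (2 : ℂ) • quad T (x * form m k * y) := by
    rw [quad_mul_form_mul]
    simp only [Finset.smul_sum, smul_smul]
    refine Finset.sum_congr rfl fun a _ => Finset.sum_congr rfl fun b _ =>
      Finset.sum_congr rfl fun c _ => Finset.sum_congr rfl fun d _ => ?_
    congr 1
    ring
  have h2 : ∑ a, ∑ b, ∑ c, ∑ d, (x a b * y c d * (2 * sgn b c * form m k b d)) • T a c =
      -((2 : ℂ) • quad T (x * form m k * y)) := by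
    rw [quad_mul_form_mul]
    simp only [Finset.smul_sum, smul_smul, ← Finset.sum_neg_distrib, ← neg_smul]
    refine Finset.sum_congr rfl fun a _ => Finset.sum_congr rfl fun b _ => ?_
    rw [Finset.sum_comm]
    refine Finset.sum_congr rfl fun d _ => Finset.sum_congr rfl fun c _ => ?_
    congr 1
    by_cases h : form m k b d = 0
    · simp [h]
    · have hs : sgn b c * sgn c d = 1 := by
        rw [sgn_comm c d, sgn, sgn, ← deg_eq_of_form_ne_zero h, ← sgn, sgn_mul_self]
      rw [hy c d]
      linear_combination (-2 * x a b * y d c * form m k b d) * hs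
  have hsign : ∀ a b c d, x a b ≠ 0 → y c d ≠ 0 →
      (-1 : ℂ) ^ (i.val * j.val) = sgn a c * sgn a d * sgn b c * sgn b d := by
    intro a b c d hab hcd
    rw [← neg_one_pow_deg_add]
    have h1 : deg a + deg b = i := by
      by_contra h; exact hab (hxi a b h)
    have h2 : deg c + deg d = j := by
      by_contra h; exact hcd (hyj c d h)
    rw [h1, h2]
  have h4 : ∑ a, ∑ b, ∑ c, ∑ d,
        (x a b * y c d * (2 * sgn b c * sgn b d * sgn a c * form m k a d)) • T c b =
      (2 * (-1 : ℂ) ^ (i.val * j.val)) • quad T (y * form m k * x) := by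
    rw [quad_mul_form_mul, sum_four_rotate]
    simp only [Finset.smul_sum, smul_smul]
    refine Finset.sum_congr rfl fun c _ => Finset.sum_congr rfl fun d _ =>
      Finset.sum_congr rfl fun a _ => Finset.sum_congr rfl fun b _ => ?_
    congr 1
    by_cases hab : x a b = 0
    · simp [hab]
    by_cases hcd : y c d = 0
    · simp [hcd]
    rw [hsign a b c d hab hcd, form_swap a d]
    ring
  have h3 : ∑ a, ∑ b, ∑ c, ∑ d,
        (x a b * y c d * (2 * sgn b c * sgn b d * form m k a c)) • T d b =
      -((2 * (-1 : ℂ) ^ (i.val * j.val)) • quad T (y * form m k * x)) := by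
    rw [quad_mul_form_mul, sum_four_rotate, Finset.sum_comm]
    simp only [Finset.smul_sum, smul_smul, ← Finset.sum_neg_distrib, ← neg_smul]
    refine Finset.sum_congr rfl fun d _ => Finset.sum_congr rfl fun c _ =>
      Finset.sum_congr rfl fun a _ => Finset.sum_congr rfl fun b _ => ?_
    congr 1
    by_cases hab : x a b = 0
    · simp [hab]
    by_cases hcd : y c d = 0
    · have : y d c = 0 := by rw [hy d c, hcd]; simp
      simp [hcd, this]
    by_cases h : form m k a c = 0
    · simp [h, form_swap c a]
    have hs : sgn a d * sgn c d = 1 := by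
      rw [sgn, sgn, ← deg_eq_of_form_ne_zero h, ← sgn, sgn_mul_self]
    rw [hsign a b c d hab hcd, form_swap a c, hy c d]
    have hs' := sgn_mul_self c d
    have had : sgn a d = sgn c d := by
      linear_combination sgn c d * hs - sgn a d * hs'
    rw [had]
    ring
  rw [hlhs]
  simp only [hT.bracket, smul_sub, smul_add, smul_smul, Finset.sum_sub_distrib,
    Finset.sum_add_distrib, h1, h2, h3, h4]
  module

end PairSymbol

end Osp

/-! ### Isomorphisms given by injective linear maps -/

section Transport

variable {A : Type*} [Ring A] [Algebra ℂ A] {𝒜 : ZMod 2 → Submodule ℂ A} [GradedAlgebra 𝒜]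

lemma zmod_two_eq (i : ZMod 2) : i = 0 ∨ i = 1 := by
  revert i; decide

/-- An injective linear map that preserves degrees and super brackets is an isomorphism onto its
image, a Lie sub-superalgebra. -/
lemma LieSubsuperalgebra.exists_iso_of_injective {B : Type*} [Ring B] [Algebra ℂ B]
    {ℬ : ZMod 2 → Submodule ℂ B} [GradedAlgebra ℬ] (M : LieSubsuperalgebra ℬ) (f : B →ₗ[ℂ] A)
    (hinj : ∀ x ∈ M.toSubmodule, f x = 0 → x = 0)
    (hdeg : ∀ i, ∀ x ∈ ℬ i, f x ∈ 𝒜 i)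
    (hbr : ∀ x ∈ M.toSubmodule, ∀ y ∈ M.toSubmodule,
      superBracket 𝒜 (f x) (f y) = f (superBracket ℬ x y)) :
    ∃ L : LieSubsuperalgebra 𝒜, L.toSubmodule = M.toSubmodule.map f ∧ L.Iso M := by
  have hproj : ∀ (i : ZMod 2) (x : B),
      GradedAlgebra.proj 𝒜 i (f x) = f (GradedAlgebra.proj ℬ i x) := by
    intro i x
    conv_lhs => rw [eq_proj_add_proj ℬ x, map_add, map_add,
      proj_of_mem 𝒜 (hdeg 0 _ (proj_mem ℬ 0 x)), proj_of_mem 𝒜 (hdeg 1 _ (proj_mem ℬ 1 x))]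
    rcases zmod_two_eq i with rfl | rfl <;> simp
  let L : LieSubsuperalgebra 𝒜 :=
    { toSubmodule := M.toSubmodule.map f
      proj_mem' := by
        rintro i _ ⟨x, hx, rfl⟩
        rw [hproj]
        exact ⟨_, M.proj_mem' i hx, rfl⟩
      bracket_mem' := by
        rintro _ _ ⟨x, hx, rfl⟩ ⟨y, hy, rfl⟩
        rw [hbr x hx y hy]
        exact ⟨_, M.bracket_mem' hx hy, rfl⟩ }
  have hdis : Function.Injective (f.domRestrict M.toSubmodule) := by
    rw [← LinearMap.ker_eq_bot, LinearMap.ker_eq_bot']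
    intro x hx
    exact Subtype.ext (hinj x x.2 hx)
  let e : M.toSubmodule ≃ₗ[ℂ] L.toSubmodule :=
    (LinearEquiv.ofInjective _ hdis).trans
      (LinearEquiv.ofEq _ _ (by rw [LinearMap.range_domRestrict]))
  have he : ∀ x : M.toSubmodule, (e x : A) = f x := fun x => rfl
  refine ⟨L, rfl, e.symm, ?_, ?_⟩
  · intro i y hy
    obtain ⟨x, rfl⟩ := e.surjective y
    rw [LinearEquiv.symm_apply_apply]
    rw [he] at hy
    have h := hproj i x
    rw [proj_of_mem 𝒜 hy, if_pos rfl] at h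
    have hx : (x : B) - GradedAlgebra.proj ℬ i x = 0 :=
      hinj _ (Submodule.sub_mem _ x.2 (M.proj_mem' i x.2)) (by rw [map_sub, h, sub_self])
    rw [sub_eq_zero.mp hx]
    exact proj_mem ℬ i _
  · intro y z
    obtain ⟨x, rfl⟩ := e.surjective y
    obtain ⟨w, rfl⟩ := e.surjective z
    rw [LinearEquiv.symm_apply_apply, LinearEquiv.symm_apply_apply, LinearEquiv.symm_apply_eq]
    exact Subtype.ext (hbr x x.2 w w.2)

variable {𝔩 : Type*} [LieRing 𝔩] [LieAlgebra ℂ 𝔩]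

lemma LieSubsuperalgebra.isoLie_of_injective (L : LieSubsuperalgebra 𝒜) (f : 𝔩 →ₗ[ℂ] A)
    (hinj : Function.Injective f) (hdeg : ∀ x, f x ∈ 𝒜 0)
    (hbr : ∀ x y, superBracket 𝒜 (f x) (f y) = f ⁅x, y⁆)
    (hL : L.toSubmodule = LinearMap.range f) : L.IsoLie 𝔩 := by
  let e : 𝔩 ≃ₗ[ℂ] L.toSubmodule :=
    (LinearEquiv.ofInjective f hinj).trans (LinearEquiv.ofEq _ _ hL.symm)
  refine ⟨?_, e.symm, ?_⟩
  · rw [hL]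
    rintro _ ⟨x, rfl⟩
    exact hdeg x
  · intro y z
    obtain ⟨x, rfl⟩ := e.surjective y
    obtain ⟨w, rfl⟩ := e.surjective z
    rw [LinearEquiv.symm_apply_apply, LinearEquiv.symm_apply_apply, LinearEquiv.symm_apply_eq]
    exact Subtype.ext (hbr x w)

lemma LieSubsuperalgebra.exists_toSubmodule_eq_range (f : 𝔩 →ₗ[ℂ] A) (hdeg : ∀ x, f x ∈ 𝒜 0)
    (hbr : ∀ x y, superBracket 𝒜 (f x) (f y) = f ⁅x, y⁆) :
    ∃ L : LieSubsuperalgebra 𝒜, L.toSubmodule = LinearMap.range f :=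
  ⟨{ toSubmodule := LinearMap.range f
     proj_mem' := by
      rintro i _ ⟨x, rfl⟩
      rw [proj_of_mem 𝒜 (hdeg x)]
      split_ifs
      · exact ⟨x, rfl⟩
      · exact Submodule.zero_mem _
     bracket_mem' := by
      rintro _ _ ⟨x, rfl⟩ ⟨y, rfl⟩
      exact ⟨⁅x, y⁆, (hbr x y).symm⟩ }, rfl⟩

end Transport

namespace Osp

variable {m k : ℕ}

section PairSymbol

variable {A : Type*} [Ring A] [Algebra ℂ A] {𝒜 : ZMod 2 → Submodule ℂ A} [GradedAlgebra 𝒜]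

/-! ### The quadratic realization of the orthosymplectic Lie superalgebra -/

/-- The map `X ↦ (1/4) ∑ (X form⁻¹) a b • T a b`. On `osp(m, 2k)` this is the Lie superalgebra
analogue of the spin and metaplectic representations. -/
def spin (T : Idx m k → Idx m k → A) : Mat m k →ₗ[ℂ] A :=
  (4⁻¹ : ℂ) • (quad T ∘ₗ LinearMap.mulRight ℂ (formInv m k))

lemma spin_apply (T : Idx m k → Idx m k → A) (X : Mat m k) :
    spin T X = (4⁻¹ : ℂ) • quad T (X * formInv m k) := rfl

lemma spin_mul_form (T : Idx m k → Idx m k → A) (x : Mat m k) :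
    spin T (x * form m k) = (4⁻¹ : ℂ) • quad T x := by
  rw [spin_apply, Matrix.mul_assoc, form_mul_formInv, Matrix.mul_one]

/-- The only relation between the `T a b` is the supersymmetry `IsPairSymbol.swap`. -/
def Nondegenerate (T : Idx m k → Idx m k → A) : Prop :=
  ∀ x ∈ superAnti m k, quad T x = 0 → x = 0

lemma Nondegenerate.spin_eq_zero {T : Idx m k → Idx m k → A} (hT : Nondegenerate T) {X : Mat m k}
    (hX : X ∈ (osp m k).toSubmodule) (h : spin T X = 0) : X = 0 := by
  have h0 := hT _ (mul_formInv_mem_superAnti hX)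
    ((smul_eq_zero.mp h).resolve_left (by norm_num))
  have h1 := congrArg (· * form m k) h0
  simpa [Matrix.mul_assoc, formInv_mul_form] using h1

namespace IsPairSymbol

variable {T : Idx m k → Idx m k → A}

omit [GradedAlgebra 𝒜] in
lemma quad_mem (hT : IsPairSymbol 𝒜 T) {s : ZMod 2} {x : Mat m k} (hx : x ∈ glGrading m k s) :
    quad T x ∈ 𝒜 s := by
  rw [quad_apply]
  refine Submodule.sum_mem _ fun a _ => Submodule.sum_mem _ fun b _ => ?_
  by_cases h : deg a + deg b = s
  · exact Submodule.smul_mem _ _ (h ▸ hT.mem a b)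
  · rw [hx a b h, zero_smul]
    exact Submodule.zero_mem _

omit [GradedAlgebra 𝒜] in
lemma spin_mem (hT : IsPairSymbol 𝒜 T) {s : ZMod 2} {X : Mat m k} (hX : X ∈ glGrading m k s) :
    spin T X ∈ 𝒜 s :=
  Submodule.smul_mem _ _ (hT.quad_mem (mul_formInv_mem hX))

lemma spin_bracket (hT : IsPairSymbol 𝒜 T) {X Y : Mat m k}
    (hY : Y ∈ (osp m k).toSubmodule) :
    superBracket 𝒜 (spin T X) (spin T Y) = spin T (superBracket (glGrading m k) X Y) := by
  have key : ∀ i j, superBracket 𝒜 (spin T (GradedAlgebra.proj (glGrading m k) i X))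
      (spin T (GradedAlgebra.proj (glGrading m k) j Y)) =
      spin T (superBracket (glGrading m k) (GradedAlgebra.proj (glGrading m k) i X)
        (GradedAlgebra.proj (glGrading m k) j Y)) := by
    intro i j
    have hXi := proj_mem (glGrading m k) i X
    have hYj := proj_mem (glGrading m k) j Y
    have hY' : GradedAlgebra.proj (glGrading m k) j Y ∈ (osp m k).toSubmodule :=
      (osp m k).proj_mem' j hY
    generalize GradedAlgebra.proj (glGrading m k) i X = X' at *
    generalize GradedAlgebra.proj (glGrading m k) j Y = Y' at *
    have hc : ∀ Z : Mat m k, Z * formInv m k * form m k = Z := fun Z => by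
      rw [Matrix.mul_assoc, formInv_mul_form, Matrix.mul_one]
    rw [superBracket_of_mem _ hXi hYj, spin_apply, spin_apply, map_smul, LinearMap.map_smul₂,
      hT.bracket_quad (mul_formInv_mem hXi) (mul_formInv_mem hYj)
        (mul_formInv_mem_superAnti hY'), hc, hc, map_sub, map_smul, spin_apply, spin_apply,
      Matrix.mul_assoc, Matrix.mul_assoc]
    module
  rw [eq_proj_add_proj (glGrading m k) X, eq_proj_add_proj (glGrading m k) Y]
  simp only [map_add, LinearMap.add_apply, key]

end IsPairSymbol

/-! ### Subspaces spanned by blocks of normally ordered products -/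

/-- The span of the elements `T a b - form a b`, that is, of the super-antisymmetrized products,
over all pairs `(a, b)` in the relation `P`. -/
def block (T : Idx m k → Idx m k → A) (P : Idx m k → Idx m k → Prop) : Submodule ℂ A :=
  Submodule.span ℂ {y | ∃ a b, P a b ∧ T a b - form m k a b • (1 : A) = y}

variable (m k) in
/-- The super-antisymmetric matrices whose nonzero entries are at places in the relation `P`. -/
def superAntiOn (P : Idx m k → Idx m k → Prop) : Submodule ℂ (Mat m k) where
  carrier := {x | x ∈ superAnti m k ∧ ∀ a b, ¬ P a b → x a b = 0}
  add_mem' := by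
    rintro x y ⟨hx, hx'⟩ ⟨hy, hy'⟩
    exact ⟨add_mem hx hy, fun a b h => by simp [hx' a b h, hy' a b h]⟩
  zero_mem' := ⟨zero_mem _, fun a b _ => rfl⟩
  smul_mem' := by
    rintro c x ⟨hx, hx'⟩
    exact ⟨Submodule.smul_mem _ c hx, fun a b h => by simp [hx' a b h]⟩

lemma quad_single (T : Idx m k → Idx m k → A) (a b : Idx m k) (c : ℂ) :
    quad T (Matrix.single a b c) = c • T a b := by
  rw [quad_apply, Finset.sum_eq_single a, Finset.sum_eq_single b]
  · simp
  · intro b' _ h; simp [h.symm]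
  · simp
  · intro a' _ h; simp [h.symm]
  · simp

lemma single_sub_mem_superAnti (a b : Idx m k) :
    Matrix.single a b (1 : ℂ) - sgn a b • Matrix.single b a (1 : ℂ) ∈ superAnti m k := by
  intro c d
  have h := sgn_mul_self a b
  by_cases h1 : a = c <;> by_cases h2 : b = d <;> by_cases h3 : b = c <;> by_cases h4 : a = d <;>
    simp_all [sgn_comm]
  linear_combination -h

omit [GradedAlgebra 𝒜] in
/-- The block of `P` consists of the quadratic expressions with coefficients supported on `P`. -/
lemma IsPairSymbol.block_eq {T : Idx m k → Idx m k → A} (hT : IsPairSymbol 𝒜 T)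
    {P : Idx m k → Idx m k → Prop} (hP : ∀ a b, P a b → P b a) :
    block T P = (superAntiOn m k P).map (quad T) := by
  apply le_antisymm
  · rw [block, Submodule.span_le]
    rintro _ ⟨a, b, hab, rfl⟩
    refine ⟨(2⁻¹ : ℂ) • (Matrix.single a b (1 : ℂ) - sgn a b • Matrix.single b a (1 : ℂ)),
      Submodule.smul_mem _ _ ⟨single_sub_mem_superAnti a b, ?_⟩, ?_⟩
    · intro c d hcd
      have h1 : ¬ (a = c ∧ b = d) := by rintro ⟨rfl, rfl⟩; exact hcd hab
      have h2 : ¬ (b = c ∧ a = d) := by rintro ⟨rfl, rfl⟩; exact hcd (hP _ _ hab)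
      simp [h1, h2]
    · have h : sgn a b • T b a = (2 * form m k a b) • (1 : A) - T a b := by
        rw [hT.swap a b]; abel
      rw [map_smul, map_sub, map_smul, quad_single, quad_single, one_smul, one_smul, h]
      module
  · rintro _ ⟨x, ⟨hx, hxP⟩, rfl⟩
    -- `x` is super-antisymmetric and the form supersymmetric, so the scalar parts add up to zero.
    have h0 : ∑ a, ∑ b, x a b * form m k a b = 0 := by
      have h : ∑ a, ∑ b, x a b * form m k a b = -∑ a, ∑ b, x a b * form m k a b := by
        conv_rhs => rw [Finset.sum_comm]
        simp only [← Finset.sum_neg_distrib]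
        refine Finset.sum_congr rfl fun a _ => Finset.sum_congr rfl fun b _ => ?_
        rw [hx a b, form_swap a b]
        linear_combination (-x b a * form m k b a) * sgn_mul_self a b
      exact self_eq_neg.mp h
    have h : quad T x = ∑ a, ∑ b, x a b • (T a b - form m k a b • (1 : A)) := by
      simp only [smul_sub, Finset.sum_sub_distrib, smul_smul, ← Finset.sum_smul, h0, zero_smul,
        sub_zero]
      rfl
    rw [h]
    refine Submodule.sum_mem _ fun a _ => Submodule.sum_mem _ fun b _ => ?_
    by_cases hab : P a b
    · exact Submodule.smul_mem _ _ (Submodule.subset_span ⟨a, b, hab, rfl⟩)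
    · rw [hxP a b hab, zero_smul]
      exact Submodule.zero_mem _

lemma block_iSup {ι : Sort*} (T : Idx m k → Idx m k → A) (P : ι → Idx m k → Idx m k → Prop) :
    block T (fun a b => ∃ i, P i a b) = ⨆ i, block T (P i) := by
  apply le_antisymm
  · rw [block, Submodule.span_le]
    rintro _ ⟨a, b, ⟨i, hab⟩, rfl⟩
    exact Submodule.mem_iSup_of_mem i (Submodule.subset_span ⟨a, b, hab, rfl⟩)
  · refine iSup_le fun i => Submodule.span_mono ?_
    rintro _ ⟨a, b, hab, rfl⟩
    exact ⟨a, b, ⟨i, hab⟩, rfl⟩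

lemma block_mono {T : Idx m k → Idx m k → A} {P Q : Idx m k → Idx m k → Prop}
    (h : ∀ a b, P a b → Q a b) : block T P ≤ block T Q := by
  refine Submodule.span_mono ?_
  rintro _ ⟨a, b, hab, rfl⟩
  exact ⟨a, b, h a b hab, rfl⟩

lemma block_congr {T : Idx m k → Idx m k → A} {P Q : Idx m k → Idx m k → Prop}
    (h : ∀ a b, P a b ↔ Q a b) : block T P = block T Q :=
  le_antisymm (block_mono fun a b => (h a b).mp) (block_mono fun a b => (h a b).mpr)

omit [GradedAlgebra 𝒜] in
lemma IsPairSymbol.disjoint_block {T : Idx m k → Idx m k → A} (hT : IsPairSymbol 𝒜 T)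
    (hnd : Nondegenerate T) {P Q : Idx m k → Idx m k → Prop} (hP : ∀ a b, P a b → P b a)
    (hQ : ∀ a b, Q a b → Q b a) (hPQ : ∀ a b, P a b → ¬ Q a b) :
    Disjoint (block T P) (block T Q) := by
  rw [hT.block_eq hP, hT.block_eq hQ, Submodule.disjoint_def]
  rintro _ ⟨x, ⟨hx, hxP⟩, rfl⟩ ⟨y, ⟨hy, hyQ⟩, hxy⟩
  have h := hnd (x - y) (sub_mem hx hy) (by rw [map_sub, hxy, sub_self])
  have hx0 : x = 0 := by
    ext a b
    by_cases hab : P a b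
    · have h' := congrFun (congrFun h a) b
      rw [Matrix.sub_apply, hyQ a b (hPQ a b hab), sub_zero] at h'
      exact h'
    · exact hxP a b hab
  rw [hx0, map_zero]

omit [GradedAlgebra 𝒜] in
/-- Blocks of disjoint relations are independent. -/
lemma IsPairSymbol.isDirectSum_block {T : Idx m k → Idx m k → A} (hT : IsPairSymbol 𝒜 T)
    (hnd : Nondegenerate T) {r : ℕ} {P : Fin r → Idx m k → Idx m k → Prop}
    {Q : Idx m k → Idx m k → Prop} (hQ : ∀ a b, Q a b ↔ ∃ i, P i a b)
    (hP : ∀ i a b, P i a b → P i b a) (hdisj : ∀ i j a b, P i a b → P j a b → i = j) :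
    IsDirectSum (block T Q) (fun i => block T (P i)) := by
  refine ⟨?_, by rw [block_congr hQ, block_iSup]⟩
  intro i
  have h : ⨆ j, ⨆ (_ : j ≠ i), block T (P j) = block T (fun a b => ∃ j, ∃ _ : j ≠ i, P j a b) := by
    rw [block_iSup]
    congr! 2 with j
    rw [block_iSup]
  rw [h]
  refine hT.disjoint_block hnd (hP i) ?_ ?_
  · rintro a b ⟨j, hj, hab⟩
    exact ⟨j, hj, hP j a b hab⟩
  · rintro a b hab ⟨j, hj, hab'⟩
    exact hj (hdisj j i a b hab' hab)

/-- The elements `T a b - form a b` span a copy of `osp(m, 2k)`. -/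
lemma IsPairSymbol.exists_iso_osp {T : Idx m k → Idx m k → A} (hT : IsPairSymbol 𝒜 T)
    (hnd : Nondegenerate T) :
    ∃ L : LieSubsuperalgebra 𝒜, L.toSubmodule = block T (fun _ _ => True) ∧ L.Iso (osp m k) := by
  obtain ⟨L, hL, hiso⟩ := (osp m k).exists_iso_of_injective (𝒜 := 𝒜) (spin T)
    (fun X hX h => hnd.spin_eq_zero hX h) (fun i X hX => hT.spin_mem hX)
    (fun _ _ _ hY => hT.spin_bracket hY)
  refine ⟨L, ?_, hiso⟩
  rw [hL, hT.block_eq (fun _ _ _ => trivial)]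
  apply le_antisymm
  · rintro _ ⟨X, hX, rfl⟩
    refine ⟨(4⁻¹ : ℂ) • (X * formInv m k), Submodule.smul_mem _ _
      ⟨mul_formInv_mem_superAnti hX, fun a b h => absurd trivial h⟩, ?_⟩
    rw [map_smul, spin_apply]
  · rintro _ ⟨x, ⟨hx, -⟩, rfl⟩
    refine ⟨((4 : ℂ) • x) * form m k, (mul_form_mem_osp _).mpr (Submodule.smul_mem _ _ hx), ?_⟩
    rw [spin_mul_form, map_smul, smul_smul]
    norm_num

/-! ### Lie algebras of even orthosymplectic matrices -/

/-- A Lie algebra of even matrices in `osp(m, 2k)`, with the matrix commutator, is realized by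
quadratic expressions. -/
lemma IsPairSymbol.exists_isoLie {T : Idx m k → Idx m k → A} (hT : IsPairSymbol 𝒜 T)
    (hnd : Nondegenerate T) {𝔩 : Type*} [LieRing 𝔩] [LieAlgebra ℂ 𝔩] (f : 𝔩 →ₗ[ℂ] Mat m k)
    (hinj : Function.Injective f) (hosp : ∀ x, f x ∈ (osp m k).toSubmodule)
    (hbr : ∀ x y, f ⁅x, y⁆ = f x * f y - f y * f x) {P : Idx m k → Idx m k → Prop}
    (hP : ∀ a b, P a b → P b a) (hPdeg : ∀ a b, P a b → deg a = deg b)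
    (hrange : ∀ x ∈ superAnti m k, x * form m k ∈ LinearMap.range f ↔ ∀ a b, ¬ P a b → x a b = 0) :
    (∃ L : LieSubsuperalgebra 𝒜, L.toSubmodule = block T P) ∧
    ∀ L : LieSubsuperalgebra 𝒜, L.toSubmodule = block T P → L.IsoLie 𝔩 := by
  have hc : ∀ Z : Mat m k, Z * formInv m k * form m k = Z := fun Z => by
    rw [Matrix.mul_assoc, formInv_mul_form, Matrix.mul_one]
  have hdeg : ∀ x, f x ∈ glGrading m k 0 := by
    intro x
    rw [← hc (f x)]
    refine mul_form_mem fun a b hab => ?_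
    refine (hrange _ (mul_formInv_mem_superAnti (hosp x))).mp (by rw [hc]; exact ⟨x, rfl⟩) a b ?_
    exact fun h => hab (by rw [hPdeg a b h, CharTwo.add_self_eq_zero])
  have hblock : block T P = LinearMap.range (spin T ∘ₗ f) := by
    rw [hT.block_eq hP]
    apply le_antisymm
    · rintro _ ⟨x, ⟨hx, hxP⟩, rfl⟩
      obtain ⟨z, hz⟩ := (hrange x hx).mpr hxP
      refine ⟨(4 : ℂ) • z, ?_⟩
      rw [map_smul, LinearMap.comp_apply, hz, spin_mul_form, smul_smul]
      norm_num
    · rintro _ ⟨z, rfl⟩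
      refine ⟨(4⁻¹ : ℂ) • (f z * formInv m k), Submodule.smul_mem _ _
        ⟨mul_formInv_mem_superAnti (hosp z), ?_⟩, ?_⟩
      · exact (hrange _ (mul_formInv_mem_superAnti (hosp z))).mp (by rw [hc]; exact ⟨z, rfl⟩)
      · rw [map_smul, LinearMap.comp_apply, spin_apply]
  have hdeg' : ∀ x, (spin T ∘ₗ f) x ∈ 𝒜 0 := fun x => hT.spin_mem (hdeg x)
  have hbr' : ∀ x y, superBracket 𝒜 ((spin T ∘ₗ f) x) ((spin T ∘ₗ f) y) = (spin T ∘ₗ f) ⁅x, y⁆ := by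
    intro x y
    rw [LinearMap.comp_apply, LinearMap.comp_apply, LinearMap.comp_apply,
      hT.spin_bracket (hosp y), superBracket_of_mem _ (hdeg x) (hdeg y), hbr]
    simp
  refine ⟨?_, fun L hL => L.isoLie_of_injective (spin T ∘ₗ f) ?_ hdeg' hbr' (hL.trans hblock)⟩
  · rw [hblock]
    exact LieSubsuperalgebra.exists_toSubmodule_eq_range _ hdeg' hbr'
  · rw [← LinearMap.ker_eq_bot, LinearMap.ker_eq_bot']
    intro x hx
    exact hinj ((hnd.spin_eq_zero (hosp x) hx).trans (map_zero f).symm)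

end PairSymbol

/-! ### Restriction to a smaller orthosymplectic space -/

section Restrict

variable {m k m' k' : ℕ} {A : Type*} [Ring A] [Algebra ℂ A] {𝒜 : ZMod 2 → Submodule ℂ A}
  {T : Idx m k → Idx m k → A} {ι : Idx m' k' → Idx m k}

lemma sgn_map (hdeg : ∀ a, deg (ι a) = deg a) (a b : Idx m' k') : sgn (ι a) (ι b) = sgn a b := by
  rw [sgn, hdeg, hdeg, ← sgn]

lemma IsPairSymbol.restrict (hT : IsPairSymbol 𝒜 T) (hdeg : ∀ a, deg (ι a) = deg a)
    (hform : ∀ a b, form m k (ι a) (ι b) = form m' k' a b) :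
    IsPairSymbol 𝒜 (fun a b => T (ι a) (ι b)) where
  mem a b := by
    have h := hT.mem (ι a) (ι b)
    rwa [hdeg, hdeg] at h
  swap a b := by rw [hT.swap, hform, sgn_map hdeg]
  contract a b c d := by rw [hT.contract, hform, sgn_map hdeg]

lemma Nondegenerate.restrict (hT : Nondegenerate T) (hι : Function.Injective ι)
    (hdeg : ∀ a, deg (ι a) = deg a) : Nondegenerate (fun a b => T (ι a) (ι b)) := by
  intro x hx h
  -- the extension of `x` by zero
  let y : Mat m k := ∑ a, ∑ b, x a b • Matrix.single (ι a) (ι b) (1 : ℂ)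
  have hyy : y = (2⁻¹ : ℂ) • ∑ a, ∑ b, x a b • (Matrix.single (ι a) (ι b) (1 : ℂ) -
      sgn (ι a) (ι b) • Matrix.single (ι b) (ι a) (1 : ℂ)) := by
    have h1 : ∑ a, ∑ b, x a b • (sgn (ι a) (ι b) • Matrix.single (ι b) (ι a) (1 : ℂ)) = -y := by
      rw [Finset.sum_comm]
      simp only [y, ← Finset.sum_neg_distrib]
      refine Finset.sum_congr rfl fun a _ => Finset.sum_congr rfl fun b _ => ?_
      rw [sgn_map hdeg, hx a b, smul_smul, ← neg_smul, neg_neg, mul_comm, sgn_comm]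
    simp only [smul_sub, Finset.sum_sub_distrib, h1]
    change y = (2⁻¹ : ℂ) • y - (2⁻¹ : ℂ) • (-y)
    module
  have hy : y ∈ superAnti m k := by
    rw [hyy]
    exact Submodule.smul_mem _ _ (Submodule.sum_mem _ fun a _ => Submodule.sum_mem _ fun b _ =>
      Submodule.smul_mem _ _ (single_sub_mem_superAnti _ _))
  have hqy : quad T y = 0 := by
    rw [← h]
    simp only [y, map_sum, map_smul, quad_single, one_smul]
    rfl
  have hy0 := hT y hy hqy
  ext a b
  have hab := congrFun (congrFun hy0 (ι a)) (ι b)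
  simp only [y, Matrix.sum_apply, Matrix.smul_apply] at hab
  rw [Finset.sum_eq_single a, Finset.sum_eq_single b] at hab
  · simpa using hab
  · intro b' _ hb'; simp [hι.ne hb']
  · simp
  · intro a' _ ha'; simp [hι.ne ha']
  · simp

lemma block_restrict (hform : ∀ a b, form m k (ι a) (ι b) = form m' k' a b)
    (P : Idx m' k' → Idx m' k' → Prop) :
    block (fun a b => T (ι a) (ι b)) P =
      block T (fun c d => ∃ a b, P a b ∧ ι a = c ∧ ι b = d) := by
  unfold block
  congr 1
  ext y
  constructor
  · rintro ⟨a, b, hab, rfl⟩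
    exact ⟨ι a, ι b, ⟨a, b, hab, rfl, rfl⟩, by rw [hform]⟩
  · rintro ⟨_, _, ⟨a, b, hab, rfl, rfl⟩, rfl⟩
    exact ⟨a, b, hab, by rw [hform]⟩

end Restrict

/-! ### Generators and their products -/

section Generators

variable {n k : ℕ}

/-- The inclusion of the basis of `ℂ^(n|2k)` in that of `ℂ^(n+1|2k)`, with the first even basis
vector left out. -/
def succ : Idx n k → Idx (n + 1) k := Sum.map Fin.succ id

lemma succ_injective : Function.Injective (succ : Idx n k → Idx (n + 1) k) :=
  (Fin.succ_injective n).sumMap Function.injective_id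

variable (n k) in
/-- The first even basis vector of `ℂ^(n+1|2k)`. -/
def zero : Idx (n + 1) k := Sum.inl 0

/-- The partial inverse of `succ`. -/
def pred : Idx (n + 1) k → Option (Idx n k) :=
  Sum.elim (Fin.cases none fun i => some (Sum.inl i)) fun u => some (Sum.inr u)

@[simp] lemma pred_zero : pred (zero n k) = none := rfl

@[simp] lemma pred_succ (a : Idx n k) : pred (succ a) = some a := by
  rcases a with a | a <;> rfl

lemma eq_zero_or_succ (a : Idx (n + 1) k) : a = zero n k ∨ ∃ b, a = succ b := by
  rcases a with a | a
  · refine Fin.cases (Or.inl rfl) (fun i => Or.inr ⟨Sum.inl i, rfl⟩) a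
  · exact Or.inr ⟨Sum.inr a, rfl⟩

lemma succ_ne_zero (a : Idx n k) : succ a ≠ zero n k := by
  intro h
  have := congrArg pred h
  simp at this

@[simp] lemma deg_zero : deg (zero n k) = 0 := rfl

@[simp] lemma deg_succ (a : Idx n k) : deg (succ a) = deg a := by
  rcases a with a | a <;> rfl

@[simp] lemma form_zero_zero : form (n + 1) k (zero n k) (zero n k) = 1 := by
  simp [form, zero]

@[simp] lemma form_succ_succ (a b : Idx n k) :
    form (n + 1) k (succ a) (succ b) = form n k a b := by
  rcases a with a | a <;> rcases b with b | b <;> simp [form, succ, Matrix.one_apply]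

@[simp] lemma form_zero_succ (a : Idx n k) : form (n + 1) k (zero n k) (succ a) = 0 := by
  rcases a with a | a <;> simp [form, succ, zero, (Fin.succ_ne_zero _).symm]

@[simp] lemma form_succ_zero (a : Idx n k) : form (n + 1) k (succ a) (zero n k) = 0 := by
  rw [form_swap, form_zero_succ, mul_zero]

@[simp] lemma sgn_zero_left (a : Idx (n + 1) k) : sgn (zero n k) a = 1 := by
  simp [sgn]

@[simp] lemma sgn_zero_right (a : Idx (n + 1) k) : sgn a (zero n k) = 1 := by
  simp [sgn]

@[simp] lemma sgn_succ_succ (a b : Idx n k) : sgn (succ a) (succ b) = sgn a b := by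
  simp [sgn]

lemma sum_idx_succ {M : Type*} [AddCommMonoid M] (f : Idx (n + 1) k → M) :
    ∑ a, f a = f (zero n k) + ∑ a, f (succ a) := by
  simp only [Fintype.sum_sum_type, Fin.sum_univ_succ, add_assoc]
  rfl

variable {A : Type*} [Ring A] [Algebra ℂ A] (𝒜 : ZMod 2 → Submodule ℂ A)

/-- Homogeneous elements `e a` with the relations `e a * e b + (-1)^(deg a * deg b) e b * e a =
2 form a b` of the generators of the Clifford–Weyl algebra. -/
structure IsGenerators (e : Idx n k → A) : Prop where
  mem : ∀ a, e a ∈ 𝒜 (deg a)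
  rel : ∀ a b, e a * e b = (2 * form n k a b) • (1 : A) - sgn a b • (e b * e a)

/-- The products `e a * e b`, enlarged by one more even index `zero`. The role of `e zero * e b`
is played by `i e b`: in the Clifford–Weyl algebra with one more generator `e zero`, the
elements `-i e zero * e b` have the same relations as the `e b`. -/
def pairs (e : Idx n k → A) (a b : Idx (n + 1) k) : A :=
  match pred a, pred b with
  | none, none => 1
  | none, some b => Complex.I • e b
  | some a, none => -Complex.I • e a
  | some a, some b => e a * e b

@[simp] lemma pairs_zero_zero (e : Idx n k → A) : pairs e (zero n k) (zero n k) = 1 := rfl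

@[simp] lemma pairs_zero_succ (e : Idx n k → A) (b : Idx n k) :
    pairs e (zero n k) (succ b) = Complex.I • e b := by
  simp [pairs]

@[simp] lemma pairs_succ_zero (e : Idx n k → A) (a : Idx n k) :
    pairs e (succ a) (zero n k) = -Complex.I • e a := by
  simp [pairs]

@[simp] lemma pairs_succ_succ (e : Idx n k → A) (a b : Idx n k) :
    pairs e (succ a) (succ b) = e a * e b := by
  simp [pairs]

variable {𝒜}

lemma IsGenerators.isPairSymbol [SetLike.GradedMonoid 𝒜] {e : Idx n k → A}
    (he : IsGenerators 𝒜 e) : IsPairSymbol 𝒜 (pairs e) where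
  mem a b := by
    obtain rfl | ⟨a, rfl⟩ := eq_zero_or_succ a <;> obtain rfl | ⟨b, rfl⟩ := eq_zero_or_succ b
    · simpa using SetLike.one_mem_graded 𝒜
    · simpa using Submodule.smul_mem _ _ (he.mem b)
    · simpa using Submodule.smul_mem _ Complex.I (he.mem a)
    · simpa using SetLike.mul_mem_graded (he.mem a) (he.mem b)
  swap a b := by
    obtain rfl | ⟨a, rfl⟩ := eq_zero_or_succ a <;> obtain rfl | ⟨b, rfl⟩ := eq_zero_or_succ b
    · simp only [pairs_zero_zero, form_zero_zero, sgn_zero_left]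
      module
    · simp
    · simp
    · simpa using he.rel a b
  contract a b c d := by
    have hI := Complex.I_mul_I
    have hrel : ∀ b c Y, e b * (e c * Y) =
        (2 * form n k b c) • Y - sgn b c • (e c * (e b * Y)) := by
      intro b c Y
      rw [← mul_assoc, he.rel b c, sub_mul, smul_mul_assoc, smul_mul_assoc, one_mul, mul_assoc]
    obtain rfl | ⟨b, rfl⟩ := eq_zero_or_succ b <;> obtain rfl | ⟨c, rfl⟩ := eq_zero_or_succ c <;>
    obtain rfl | ⟨a, rfl⟩ := eq_zero_or_succ a <;> obtain rfl | ⟨d, rfl⟩ := eq_zero_or_succ d <;>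
    simp only [pairs_zero_zero, pairs_zero_succ, pairs_succ_zero, pairs_succ_succ, form_zero_zero,
      form_zero_succ, form_succ_zero, form_succ_succ, sgn_zero_left, sgn_zero_right, sgn_succ_succ,
      mul_one, one_mul, smul_mul_assoc, mul_smul_comm, mul_assoc, smul_smul, neg_mul, mul_neg, hI]
    all_goals try module
    all_goals
      first
        | rw [he.rel b c]
        | rw [hrel b c]
      simp only [mul_sub, mul_smul_comm, mul_one, smul_sub, smul_smul]
      try module

variable [GradedAlgebra 𝒜]

omit [GradedAlgebra 𝒜] in
/-- In a nontrivial algebra, generators are linearly independent: their (anti)commutators with the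
`e b` recover the coefficients of a linear combination. -/
lemma IsGenerators.sum_eq_zero [Nontrivial A] {e : Idx n k → A} (he : IsGenerators 𝒜 e)
    {c : Idx n k → ℂ} (hc : ∑ a, c a • e a = 0) (a : Idx n k) : c a = 0 := by
  -- In `(∑ c a • e a) * e b + t • e b * (∑ c a • e a)` the products cancel if `t = sgn a b`
  -- wherever `c a ≠ 0`. For even `b` this holds with `t = 1`; this gives `c a = 0` for even `a`, so
  -- that `t = -1` is possible for odd `b`.
  have hanti : ∀ (t : ℂ) b, (∀ a, c a * (t - sgn a b) = 0) → ∑ a, c a * form n k a b = 0 := by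
    intro t b hb
    have h1 : (∑ a, c a * (2 * form n k a b)) • (1 : A) =
        (∑ a, c a • e a) * e b + t • (e b * ∑ a, c a • e a) := by
      rw [Finset.sum_mul, Finset.mul_sum, Finset.sum_smul, Finset.smul_sum,
        ← Finset.sum_add_distrib]
      refine Finset.sum_congr rfl fun a _ => ?_
      have h0 : (c a * (t - sgn a b)) • (e b * e a) = 0 := by rw [hb a, zero_smul]
      rw [smul_mul_assoc, mul_smul_comm, he.rel a b, ← add_zero ((c a * _) • (1 : A)), ← h0]
      module
    rw [hc, zero_mul, mul_zero, smul_zero, add_zero] at h1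
    have h2 := (smul_eq_zero.mp h1).resolve_right one_ne_zero
    have h3 : (2 : ℂ) * ∑ a, c a * form n k a b = 0 := by
      rw [← h2, Finset.mul_sum]
      exact Finset.sum_congr rfl fun a _ => by ring
    exact (mul_eq_zero.mp h3).resolve_left two_ne_zero
  have hsolve : ∀ δ : ZMod 2, (∀ b, deg b = δ → ∑ a, c a * form n k a b = 0) →
      ∀ b, deg b = δ → c b = 0 := by
    intro δ h b hb
    have h1 : Matrix.vecMul (Matrix.vecMul c (form n k)) (formInv n k) = c := by
      rw [Matrix.vecMul_vecMul, form_mul_formInv, Matrix.vecMul_one]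
    rw [← h1]
    change ∑ d, Matrix.vecMul c (form n k) d * formInv n k d b = 0
    refine Finset.sum_eq_zero fun d _ => ?_
    by_cases hd : deg d = δ
    · have h2 : Matrix.vecMul c (form n k) d = 0 := h d hd
      rw [h2, zero_mul]
    · rw [formInv_mem_zero d b, mul_zero]
      rw [hb]
      intro h0
      exact hd (by rw [← add_zero (deg d), ← CharTwo.add_self_eq_zero δ, ← add_assoc, h0, zero_add])
  have h0 : ∀ b, deg b = 0 → c b = 0 := hsolve 0 fun b hb => hanti 1 b fun a => by
    simp [sgn, hb]
  have h1 : ∀ b, deg b = 1 → c b = 0 := hsolve 1 fun b hb => hanti (-1) b fun a => by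
    rcases deg_eq_zero_or_one a with ha | ha
    · rw [h0 a ha, zero_mul]
    · simp [sgn, ha, hb, ZMod.val_one]
  rcases deg_eq_zero_or_one a with ha | ha
  · exact h0 a ha
  · exact h1 a ha

lemma IsGenerators.bracket_mul {e : Idx n k → A} (he : IsGenerators 𝒜 e) (a b w : Idx n k) :
    superBracket 𝒜 (e a * e b) (e w) =
      (2 * form n k b w) • e a - (2 * sgn b w * form n k a w) • e b := by
  rw [superBracket_of_mem 𝒜 (SetLike.mul_mem_graded (he.mem a) (he.mem b)) (he.mem w),
    neg_one_pow_deg_add_mul]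
  have h1 : e a * e b * e w = (2 * form n k b w) • e a - sgn b w • (e a * e w * e b) := by
    rw [mul_assoc, he.rel b w, mul_sub, mul_smul_comm, mul_one, mul_smul_comm, mul_assoc]
  have h2 : e a * e w * e b = (2 * form n k a w) • e b - sgn a w • (e w * (e a * e b)) := by
    rw [he.rel a w, sub_mul, smul_mul_assoc, one_mul, smul_mul_assoc, mul_assoc]
  rw [h1, h2]
  module

lemma IsGenerators.bracket {e : Idx n k → A} (he : IsGenerators 𝒜 e) (a b : Idx n k) :
    superBracket 𝒜 (e a) (e b) = (2 : ℂ) • (e a * e b - form n k a b • (1 : A)) := by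
  have h : sgn a b • (e b * e a) = (2 * form n k a b) • (1 : A) - e a * e b := by
    rw [he.rel a b]; abel
  rw [superBracket_of_mem 𝒜 (he.mem a) (he.mem b), ← sgn, h]
  module

/-- Super-antisymmetric quadratic expressions in the generators are determined by their brackets
with the generators. -/
lemma IsGenerators.quad_eq_zero [Nontrivial A] {e : Idx n k → A} (he : IsGenerators 𝒜 e)
    {x : Mat n k} (hx : x ∈ superAnti n k) (h : quad (fun a b => e a * e b) x = 0) : x = 0 := by
  have hbr : ∀ w, ∑ a, (4 * (x * form n k) a w) • e a = 0 := by
    intro w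
    have h1 : superBracket 𝒜 (quad (fun a b => e a * e b) x) (e w) = 0 := by rw [h]; simp
    rw [← h1]
    simp only [quad_apply, map_sum, LinearMap.sum_apply, map_smul, LinearMap.smul_apply,
      he.bracket_mul, smul_sub, Finset.sum_sub_distrib, smul_smul]
    have h2 : ∑ a, ∑ b, (x a b * (2 * sgn b w * form n k a w)) • e b =
        -∑ a, ∑ b, (x a b * (2 * form n k b w)) • e a := by
      rw [Finset.sum_comm]
      simp only [← Finset.sum_neg_distrib, ← neg_smul]
      refine Finset.sum_congr rfl fun a _ => Finset.sum_congr rfl fun b _ => ?_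
      congr 1
      by_cases hb : form n k b w = 0
      · simp [hb]
      · have hs : sgn a w = sgn b a := by
          rw [sgn_comm, sgn, sgn, deg_eq_of_form_ne_zero hb]
        rw [hx b a, hs]
        linear_combination (-2 * x a b * form n k b w) * sgn_mul_self b a
    rw [h2, sub_neg_eq_add, ← Finset.sum_add_distrib]
    refine Finset.sum_congr rfl fun a _ => ?_
    rw [← Finset.sum_smul, ← add_smul, Matrix.mul_apply, Finset.mul_sum, ← Finset.sum_add_distrib]
    congr 1
    exact Finset.sum_congr rfl fun b _ => by ring
  have h0 : x * form n k = 0 := by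
    ext a w
    have := he.sum_eq_zero (hbr w) a
    simpa using this
  rw [← Matrix.mul_one x, ← form_mul_formInv, ← Matrix.mul_assoc, h0, Matrix.zero_mul]

/-- The products of the generators are nondegenerate if there is an automorphism that changes the
sign of all generators: it separates the linear from the quadratic part. -/
lemma IsGenerators.nondegenerate_pairs [Nontrivial A] {e : Idx n k → A} (he : IsGenerators 𝒜 e)
    (ε : A →ₐ[ℂ] A) (hε : ∀ a, ε (e a) = -e a) : Nondegenerate (pairs e) := by
  intro x hx h
  have hx0 : x (zero n k) (zero n k) = 0 := by
    have h0 := hx (zero n k) (zero n k)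
    rw [sgn_zero_left, one_mul] at h0
    exact self_eq_neg.mp h0
  have hxs : ∀ a, x (succ a) (zero n k) = -x (zero n k) (succ a) := by
    intro a
    rw [hx, sgn_zero_right, one_mul]
  let y : Mat n k := Matrix.of fun a b => x (succ a) (succ b)
  have hsplit : quad (pairs e) x = ∑ a, (2 * Complex.I * x (zero n k) (succ a)) • e a +
      quad (fun a b => e a * e b) y := by
    simp only [quad_apply, sum_idx_succ, pairs_zero_zero, pairs_zero_succ, pairs_succ_zero,
      pairs_succ_succ, hx0, hxs, zero_smul, zero_add, Finset.sum_add_distrib, ← add_assoc]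
    rw [← Finset.sum_add_distrib]
    congr 1
    refine Finset.sum_congr rfl fun a _ => ?_
    module
  rw [hsplit] at h
  have hneg := congrArg ε h
  simp only [quad_apply, map_add, map_sum, map_smul, map_mul, hε, neg_mul_neg, map_zero, smul_neg,
    Finset.sum_neg_distrib] at hneg
  rw [← quad_apply (fun a b => e a * e b) y] at hneg
  have hlin : ∑ a, (2 * Complex.I * x (zero n k) (succ a)) • e a = 0 := by
    generalize ∑ a, (2 * Complex.I * x (zero n k) (succ a)) • e a = L at *
    generalize quad (fun a b => e a * e b) y = M at *
    have h2 : (2 : ℂ) • L = (L + M) - (-L + M) := by module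
    rw [h, hneg, sub_zero] at h2
    exact (smul_eq_zero.mp h2).resolve_left two_ne_zero
  rw [hlin, zero_add] at h
  have hy : y = 0 := he.quad_eq_zero (fun a b => by
    have := hx (succ a) (succ b)
    rwa [sgn_succ_succ] at this) h
  have hz : ∀ a, x (zero n k) (succ a) = 0 := fun a => by
    simpa using he.sum_eq_zero hlin a
  ext a b
  obtain rfl | ⟨a, rfl⟩ := eq_zero_or_succ a <;> obtain rfl | ⟨b, rfl⟩ := eq_zero_or_succ b
  · exact hx0
  · exact hz b
  · rw [hxs, hz, neg_zero]; rfl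
  · exact congrFun (congrFun hy a) b

end Generators

/-! ### Even orthosymplectic matrices -/

section Even

variable (m k : ℕ)

/-- The block diagonal matrix with an orthogonal and a symplectic block. -/
def evenBlock : (LieAlgebra.Orthogonal.so (Fin m) ℂ × LieAlgebra.Symplectic.sp (Fin k) ℂ) →ₗ[ℂ]
    Mat m k where
  toFun p := Matrix.fromBlocks (p.1 : Matrix (Fin m) (Fin m) ℂ) 0 0 p.2
  map_add' p q := by simp [Matrix.fromBlocks_add]
  map_smul' c p := by simp [Matrix.fromBlocks_smul]

variable {m k}

lemma evenBlock_apply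
    (p : LieAlgebra.Orthogonal.so (Fin m) ℂ × LieAlgebra.Symplectic.sp (Fin k) ℂ) :
    evenBlock m k p = Matrix.fromBlocks (p.1 : Matrix (Fin m) (Fin m) ℂ) 0 0 p.2 := rfl

lemma evenBlock_injective : Function.Injective (evenBlock m k) := by
  intro p q h
  obtain ⟨h1, -, -, h2⟩ := Matrix.fromBlocks_inj.mp h
  exact Prod.ext (Subtype.ext h1) (Subtype.ext h2)

lemma evenBlock_lie (p q : LieAlgebra.Orthogonal.so (Fin m) ℂ × LieAlgebra.Symplectic.sp (Fin k) ℂ) :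
    evenBlock m k ⁅p, q⁆ =
      evenBlock m k p * evenBlock m k q - evenBlock m k q * evenBlock m k p := by
  have h : (evenBlock m k ⁅p, q⁆ : Mat m k) = Matrix.fromBlocks
      (p.1.1 * q.1.1 - q.1.1 * p.1.1) 0 0 (p.2.1 * q.2.1 - q.2.1 * p.2.1) := rfl
  rw [h, evenBlock_apply, evenBlock_apply, Matrix.fromBlocks_multiply, Matrix.fromBlocks_multiply,
    eq_sub_iff_add_eq, Matrix.fromBlocks_add]
  simp

lemma fromBlocks_mem_osp {X : Matrix (Fin m) (Fin m) ℂ}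
    {Y : Matrix (Fin k ⊕ Fin k) (Fin k ⊕ Fin k) ℂ} :
    (Matrix.fromBlocks X 0 0 Y : Mat m k) ∈ (osp m k).toSubmodule ↔
      X ∈ LieAlgebra.Orthogonal.so (Fin m) ℂ ∧ Y ∈ LieAlgebra.Symplectic.sp (Fin k) ℂ := by
  have h0 : (Matrix.fromBlocks X 0 0 Y : Mat m k) ∈ glGrading m k 0 := by
    intro a b h
    rcases a with a | a <;> rcases b with b | b <;> simp_all [deg]
    exact absurd (CharTwo.add_self_eq_zero _) h
  have h1 : (Matrix.fromBlocks X 0 0 Y : Mat m k) ∈ (osp m k).toSubmodule ↔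
      PreservesForm 0 (Matrix.fromBlocks X 0 0 Y : Mat m k) := by
    constructor
    · intro h
      have := h 0
      rwa [proj_of_mem _ h0, if_pos rfl] at this
    · intro h s
      rw [proj_of_mem _ h0]
      split_ifs with hs
      · rwa [hs]
      · simp [PreservesForm]
  have h2 : signMat m k 0 = 1 := by simp [signMat]
  have h3 : Y ∈ LieAlgebra.Symplectic.sp (Fin k) ℂ ↔
      Y.transpose * Matrix.J (Fin k) ℂ = -(Matrix.J (Fin k) ℂ * Y) := by
    rw [LieAlgebra.Symplectic.sp, mem_skewAdjointMatricesLieSubalgebra,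
      mem_skewAdjointMatricesSubmodule, Matrix.IsSkewAdjoint, Matrix.IsAdjointPair, Matrix.mul_neg]
  rw [h1, PreservesForm, h2, Matrix.one_mul, form, Matrix.fromBlocks_transpose,
    Matrix.fromBlocks_multiply, Matrix.fromBlocks_multiply, Matrix.fromBlocks_neg,
    Matrix.fromBlocks_inj, LieAlgebra.Orthogonal.mem_so, h3]
  simp

lemma evenBlock_mem_osp
    (p : LieAlgebra.Orthogonal.so (Fin m) ℂ × LieAlgebra.Symplectic.sp (Fin k) ℂ) :
    evenBlock m k p ∈ (osp m k).toSubmodule :=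
  fromBlocks_mem_osp.mpr ⟨p.1.2, p.2.2⟩

lemma mul_form_eq_fromBlocks_iff {x : Mat m k} {X : Matrix (Fin m) (Fin m) ℂ}
    {Y : Matrix (Fin k ⊕ Fin k) (Fin k ⊕ Fin k) ℂ} :
    x * form m k = Matrix.fromBlocks X 0 0 Y ↔
      x = Matrix.fromBlocks X 0 0 (-(Y * Matrix.J (Fin k) ℂ)) := by
  have h1 : (Matrix.fromBlocks X 0 0 Y : Mat m k) * formInv m k =
      Matrix.fromBlocks X 0 0 (-(Y * Matrix.J (Fin k) ℂ)) := by
    simp [formInv, Matrix.fromBlocks_multiply]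
  rw [← h1]
  constructor
  · intro h
    rw [← h, Matrix.mul_assoc, form_mul_formInv, Matrix.mul_one]
  · intro h
    rw [h, Matrix.mul_assoc, formInv_mul_form, Matrix.mul_one]

lemma mul_form_mem_range_evenBlock {x : Mat m k} (hx : x ∈ superAnti m k) :
    x * form m k ∈ LinearMap.range (evenBlock m k) ↔ ∀ a b, ¬ deg a = deg b → x a b = 0 := by
  constructor
  · rintro ⟨p, hp⟩ a b hab
    rw [mul_form_eq_fromBlocks_iff.mp hp.symm]
    rcases a with a | a <;> rcases b with b | b <;> simp_all [deg]
  · intro h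
    have hx' : x = Matrix.fromBlocks x.toBlocks₁₁ 0 0
        (-((x.toBlocks₂₂ * Matrix.J (Fin k) ℂ) * Matrix.J (Fin k) ℂ)) := by
      rw [Matrix.mul_assoc, Matrix.J_squared, Matrix.mul_neg, Matrix.mul_one, neg_neg]
      ext a b
      rcases a with a | a <;> rcases b with b | b
      · rfl
      · exact h _ _ (by simp [deg])
      · exact h _ _ (by simp [deg])
      · rfl
    have h1 := mul_form_eq_fromBlocks_iff.mpr hx'
    have h2 := (mul_form_mem_osp x).mpr hx
    rw [h1, fromBlocks_mem_osp] at h2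
    exact ⟨(⟨_, h2.1⟩, ⟨_, h2.2⟩), h1.symm⟩

lemma mul_form_mem_range_evenBlock_inl {x : Mat m k} (hx : x ∈ superAnti m k) :
    x * form m k ∈ LinearMap.range (evenBlock m k ∘ₗ LinearMap.inl ℂ _ _) ↔
      ∀ a b, ¬ (deg a = 0 ∧ deg b = 0) → x a b = 0 := by
  constructor
  · rintro ⟨p, hp⟩ a b hab
    rw [mul_form_eq_fromBlocks_iff.mp hp.symm]
    rcases a with a | a <;> rcases b with b | b <;> simp_all [deg]
  · intro h
    obtain ⟨p, hp⟩ := (mul_form_mem_range_evenBlock hx).mpr fun a b hab =>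
      h a b fun h0 => hab (h0.1.trans h0.2.symm)
    have h2 : p.2 = 0 := by
      have hx' := mul_form_eq_fromBlocks_iff.mp hp.symm
      have h3 : -((p.2 : Matrix (Fin k ⊕ Fin k) (Fin k ⊕ Fin k) ℂ) * Matrix.J (Fin k) ℂ) = 0 := by
        ext a b
        have h4 := h (Sum.inr a) (Sum.inr b) (by simp [deg])
        rw [hx', Matrix.fromBlocks_apply₂₂] at h4
        exact h4
      have h5 := congrArg (· * Matrix.J (Fin k) ℂ) h3
      simp only [Matrix.neg_mul, Matrix.mul_assoc, Matrix.J_squared, Matrix.mul_neg, Matrix.mul_one,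
        neg_neg, Matrix.zero_mul] at h5
      exact Subtype.ext h5
    exact ⟨p.1, by rw [← hp, LinearMap.comp_apply, LinearMap.inl_apply, ← h2]⟩

lemma mul_form_mem_range_evenBlock_inr {x : Mat m k} (hx : x ∈ superAnti m k) :
    x * form m k ∈ LinearMap.range (evenBlock m k ∘ₗ LinearMap.inr ℂ _ _) ↔
      ∀ a b, ¬ (deg a = 1 ∧ deg b = 1) → x a b = 0 := by
  constructor
  · rintro ⟨p, hp⟩ a b hab
    rw [mul_form_eq_fromBlocks_iff.mp hp.symm]
    rcases a with a | a <;> rcases b with b | b <;> simp_all [deg]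
  · intro h
    obtain ⟨p, hp⟩ := (mul_form_mem_range_evenBlock hx).mpr fun a b hab =>
      h a b fun h0 => hab (h0.1.trans h0.2.symm)
    have h1 : p.1 = 0 := by
      have hx' := mul_form_eq_fromBlocks_iff.mp hp.symm
      ext a b
      have h4 := h (Sum.inl a) (Sum.inl b) (by simp [deg])
      rw [hx', Matrix.fromBlocks_apply₁₁] at h4
      exact h4
    exact ⟨p.2, by rw [← hp, LinearMap.comp_apply, LinearMap.inr_apply, ← h1]⟩

variable {A : Type*} [Ring A] [Algebra ℂ A] {𝒜 : ZMod 2 → Submodule ℂ A} [GradedAlgebra 𝒜]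
  {T : Idx m k → Idx m k → A}

/-- The even part of `osp(m, 2k)` is `so(m) × sp(2k)`. -/
lemma IsPairSymbol.isoLie_so_prod_sp (hT : IsPairSymbol 𝒜 T) (hnd : Nondegenerate T)
    (L : LieSubsuperalgebra 𝒜) (hL : L.toSubmodule = block T (fun a b => deg a = deg b)) :
    L.IsoLie (LieAlgebra.Orthogonal.so (Fin m) ℂ × LieAlgebra.Symplectic.sp (Fin k) ℂ) :=
  (hT.exists_isoLie hnd (evenBlock m k) evenBlock_injective evenBlock_mem_osp evenBlock_lie
    (fun _ _ h => h.symm) (fun _ _ h => h) (fun _ hx => mul_form_mem_range_evenBlock hx)).2 L hL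

lemma IsPairSymbol.exists_isoLie_so (hT : IsPairSymbol 𝒜 T) (hnd : Nondegenerate T) :
    ∃ L : LieSubsuperalgebra 𝒜, L.toSubmodule = block T (fun a b => deg a = 0 ∧ deg b = 0) ∧
      L.IsoLie (LieAlgebra.Orthogonal.so (Fin m) ℂ) := by
  obtain ⟨⟨L, hL⟩, h⟩ := hT.exists_isoLie hnd (evenBlock m k ∘ₗ LinearMap.inl ℂ _ _)
    (P := fun a b => deg a = 0 ∧ deg b = 0)
    (evenBlock_injective.comp LinearMap.inl_injective) (fun x => evenBlock_mem_osp (x, 0))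
    (fun x y => by
      simp only [LinearMap.comp_apply, LinearMap.inl_apply, ← evenBlock_lie]
      congr 1
      exact Prod.ext rfl (lie_self (0 : LieAlgebra.Symplectic.sp (Fin k) ℂ)).symm)
    (fun _ _ h => h.symm) (fun _ _ h => h.1.trans h.2.symm)
    (fun _ hx => mul_form_mem_range_evenBlock_inl hx)
  exact ⟨L, hL, h L hL⟩

lemma IsPairSymbol.exists_isoLie_sp (hT : IsPairSymbol 𝒜 T) (hnd : Nondegenerate T) :
    ∃ L : LieSubsuperalgebra 𝒜, L.toSubmodule = block T (fun a b => deg a = 1 ∧ deg b = 1) ∧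
      L.IsoLie (LieAlgebra.Symplectic.sp (Fin k) ℂ) := by
  obtain ⟨⟨L, hL⟩, h⟩ := hT.exists_isoLie hnd (evenBlock m k ∘ₗ LinearMap.inr ℂ _ _)
    (P := fun a b => deg a = 1 ∧ deg b = 1)
    (evenBlock_injective.comp LinearMap.inr_injective) (fun x => evenBlock_mem_osp (0, x))
    (fun x y => by
      simp only [LinearMap.comp_apply, LinearMap.inr_apply, ← evenBlock_lie]
      congr 1
      exact Prod.ext (lie_self (0 : LieAlgebra.Orthogonal.so (Fin m) ℂ)).symm rfl)
    (fun _ _ h => h.symm) (fun _ _ h => h.1.trans h.2.symm)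
    (fun _ hx => mul_form_mem_range_evenBlock_inr hx)
  exact ⟨L, hL, h L hL⟩

/-- The homogeneous parts of the span of all `T a b - form a b`. -/
lemma IsPairSymbol.block_inf (hT : IsPairSymbol 𝒜 T) (s : ZMod 2) :
    block T (fun _ _ => True) ⊓ 𝒜 s = block T (fun a b => deg a + deg b = s) := by
  have hsymm : ∀ a b : Idx m k, deg a + deg b = s → deg b + deg a = s := fun a b h => by
    rwa [add_comm]
  apply le_antisymm
  · rw [hT.block_eq (fun _ _ _ => trivial), hT.block_eq hsymm]
    rintro _ ⟨⟨x, ⟨hx, -⟩, rfl⟩, hs⟩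
    refine ⟨GradedAlgebra.proj (glGrading m k) s x, ⟨proj_mem_superAnti hx s, fun a b hab => ?_⟩, ?_⟩
    · rw [proj_apply, if_neg hab]
    · have h : GradedAlgebra.proj 𝒜 s (quad T x) =
          quad T (GradedAlgebra.proj (glGrading m k) s x) := by
        conv_lhs => rw [eq_proj_add_proj (glGrading m k) x, map_add, map_add,
          proj_of_mem 𝒜 (hT.quad_mem (proj_mem (glGrading m k) 0 x)),
          proj_of_mem 𝒜 (hT.quad_mem (proj_mem (glGrading m k) 1 x))]
        rcases zmod_two_eq s with rfl | rfl <;> simp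
      rw [← h, proj_of_mem 𝒜 hs, if_pos rfl]
  · refine le_inf (block_mono fun _ _ _ => trivial) ?_
    rw [hT.block_eq hsymm]
    rintro _ ⟨x, ⟨-, hx⟩, rfl⟩
    exact hT.quad_mem hx

end Even

/-! ### The blocks of linear and of quadratic expressions in the generators -/

section Generated

variable {n k : ℕ} {A : Type*} [Ring A] [Algebra ℂ A] {𝒜 : ZMod 2 → Submodule ℂ A}

/-- The pairs of indices that involve `zero` and have total degree `d`. -/
def linRel (d : ZMod 2) (a b : Idx (n + 1) k) : Prop :=
  (a = zero n k ∨ b = zero n k) ∧ deg a + deg b = d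

/-- The pairs of indices that do not involve `zero` and have degrees `c` and `d`, in some order. -/
def quadRel (c d : ZMod 2) (a b : Idx (n + 1) k) : Prop :=
  a ≠ zero n k ∧ b ≠ zero n k ∧ (deg a = c ∧ deg b = d ∨ deg a = d ∧ deg b = c)

lemma linRel_symm {d : ZMod 2} (a b : Idx (n + 1) k) (h : linRel d a b) : linRel d b a :=
  ⟨h.1.symm, by rw [add_comm, h.2]⟩

lemma quadRel_symm {c d : ZMod 2} (a b : Idx (n + 1) k) (h : quadRel c d a b) : quadRel c d b a :=
  ⟨h.2.1, h.1, h.2.2.symm.imp And.symm And.symm⟩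

lemma block_linRel (e : Idx n k → A) (d : ZMod 2) :
    block (pairs e) (linRel d) = Submodule.span ℂ (e '' {a | deg a = d}) := by
  apply le_antisymm
  · rw [block, Submodule.span_le]
    rintro _ ⟨a, b, ⟨h0, hd⟩, rfl⟩
    obtain rfl | ⟨a, rfl⟩ := eq_zero_or_succ a <;> obtain rfl | ⟨b, rfl⟩ := eq_zero_or_succ b
    · simp
    · simp only [pairs_zero_succ, form_zero_succ, zero_smul, sub_zero]
      exact Submodule.smul_mem _ _ (Submodule.subset_span ⟨b, by simpa using hd, rfl⟩)
    · simp only [pairs_succ_zero, form_succ_zero, zero_smul, sub_zero]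
      exact Submodule.smul_mem _ _ (Submodule.subset_span ⟨a, by simpa using hd, rfl⟩)
    · exact absurd h0 (by simp [succ_ne_zero])
  · rw [Submodule.span_le]
    rintro _ ⟨b, hb, rfl⟩
    have h : e b = (-Complex.I) • (pairs e (zero n k) (succ b) -
        form (n + 1) k (zero n k) (succ b) • (1 : A)) := by
      simp [smul_smul]
    rw [h]
    refine Submodule.smul_mem _ _ (Submodule.subset_span ⟨_, _, ⟨Or.inl rfl, ?_⟩, rfl⟩)
    simpa using hb

lemma block_quadRel [GradedAlgebra 𝒜] {e : Idx n k → A} (he : IsGenerators 𝒜 e) (c d : ZMod 2) :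
    block (pairs e) (quadRel c d) = bracketSpan 𝒜 (Submodule.span ℂ (e '' {a | deg a = c}))
      (Submodule.span ℂ (e '' {a | deg a = d})) := by
  have hT : ∀ a b, pairs e (succ a) (succ b) - form (n + 1) k (succ a) (succ b) • (1 : A) =
      (2⁻¹ : ℂ) • superBracket 𝒜 (e a) (e b) := by
    intro a b
    rw [he.bracket, smul_smul, pairs_succ_succ, form_succ_succ]
    norm_num
  rw [bracketSpan, Submodule.map₂_span_span]
  apply le_antisymm
  · rw [block, Submodule.span_le]
    rintro _ ⟨a, b, ⟨ha, hb, hcd⟩, rfl⟩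
    obtain rfl | ⟨a, rfl⟩ := eq_zero_or_succ a
    · exact absurd rfl ha
    obtain rfl | ⟨b, rfl⟩ := eq_zero_or_succ b
    · exact absurd rfl hb
    rw [hT]
    simp only [deg_succ] at hcd
    refine Submodule.smul_mem _ _ ?_
    rcases hcd with ⟨hc, hd⟩ | ⟨hc, hd⟩
    · exact Submodule.subset_span ⟨_, ⟨a, hc, rfl⟩, _, ⟨b, hd, rfl⟩, rfl⟩
    · rw [superBracket_skew 𝒜 (he.mem a) (he.mem b)]
      exact Submodule.neg_mem _ (Submodule.smul_mem _ _
        (Submodule.subset_span ⟨_, ⟨b, hd, rfl⟩, _, ⟨a, hc, rfl⟩, rfl⟩))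
  · rw [Submodule.span_le]
    rintro _ ⟨_, ⟨a, ha, rfl⟩, _, ⟨b, hb, rfl⟩, rfl⟩
    have h : superBracket 𝒜 (e a) (e b) = (2 : ℂ) • (pairs e (succ a) (succ b) -
        form (n + 1) k (succ a) (succ b) • (1 : A)) := by
      rw [hT, smul_smul]
      norm_num
    change superBracket 𝒜 (e a) (e b) ∈ block (pairs e) (quadRel c d)
    rw [h]
    refine Submodule.smul_mem _ _ (Submodule.subset_span
      ⟨_, _, ⟨succ_ne_zero a, succ_ne_zero b, Or.inl ⟨?_, ?_⟩⟩, rfl⟩)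
    · simpa using ha
    · simpa using hb

end Generated

end Osp

/-! ### Generators of the Clifford–Weyl algebra -/

lemma pderiv_comm {σ : Type*} (i j : σ) (f : MvPolynomial σ ℂ) :
    MvPolynomial.pderiv i (MvPolynomial.pderiv j f) =
      MvPolynomial.pderiv j (MvPolynomial.pderiv i f) := by
  classical
  have h : ⁅(MvPolynomial.pderiv i : Derivation ℂ (MvPolynomial σ ℂ) (MvPolynomial σ ℂ)),
      (MvPolynomial.pderiv j : Derivation ℂ (MvPolynomial σ ℂ) (MvPolynomial σ ℂ))⁆ = 0 := by
    apply MvPolynomial.derivation_ext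
    intro l
    rw [Derivation.commutator_apply, MvPolynomial.pderiv_X, MvPolynomial.pderiv_X]
    simp [Pi.single_apply, apply_ite]
  rw [← sub_eq_zero, ← Derivation.commutator_apply, h, Derivation.zero_apply]

/-- The Weyl algebra acts on polynomials: `p_i` by `∂/∂x_i` and `q_i` by multiplication with
`x_i`. -/
def Weyl.polynomialRep (k : ℕ) : Weyl k →ₐ[ℂ] Module.End ℂ (MvPolynomial (Fin k) ℂ) :=
  Weyl.lift (Sum.elim (fun i => (MvPolynomial.pderiv i).toLinearMap)
      (fun i => LinearMap.mulLeft ℂ (MvPolynomial.X i))) (by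
    classical
    rintro (i | i) (j | j) <;> apply LinearMap.ext <;> intro f
    · simp [poisson, pderiv_comm i j f]
    · by_cases h : i = j <;>
        simp [poisson, h, MvPolynomial.pderiv_X, mul_comm, add_comm, eq_comm]
    · by_cases h : i = j <;>
        simp [poisson, h, MvPolynomial.pderiv_X, mul_comm, add_comm]
    · simp [poisson, mul_left_comm])

instance (k : ℕ) : Nontrivial (Weyl k) :=
  (Weyl.polynomialRep k).toRingHom.domain_nontrivial

namespace CW

variable (n k : ℕ)

instance : Nontrivial (CW n k) := by
  have : Invertible (2 : ℂ) := invertibleOfNonzero two_ne_zero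
  exact (GradedTensorProduct.of ℂ (cliffGrading n) (Weyl.grading k)).symm.toEquiv.nontrivial

variable {n k}

lemma inclCliff_mul_inclWeyl {i j : ZMod 2} {a : Cliff n} {b : Weyl k} (ha : a ∈ cliffGrading n i)
    (hb : b ∈ Weyl.grading k j) : inclCliff n k a * inclWeyl n k b =
      (-1 : ℤˣ) ^ (j * i) • (inclWeyl n k b * inclCliff n k a) := by
  have h := GradedTensorProduct.tmul_coe_mul_coe_tmul (R := ℂ) (cliffGrading n)
    (Weyl.grading k) 1 ⟨b, hb⟩ ⟨a, ha⟩ 1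
  simp only [one_mul, mul_one] at h
  simp only [GradedTensorProduct.includeLeft_apply, GradedTensorProduct.includeRight_apply]
  rw [h, GradedTensorProduct.tmul_one_mul_one_tmul, smul_smul, Int.units_mul_self, one_smul]

lemma parity_mem_grading {j : ZMod 2} {b : Weyl k} (hb : b ∈ Weyl.grading k j) :
    Weyl.parity k b ∈ Weyl.grading k j := by
  rw [Weyl.mem_grading] at hb ⊢
  rw [hb, map_smul, hb]

variable (n k) in
/-- The automorphism of the Clifford–Weyl algebra that changes the sign of all generators. -/
def totalParity : CW n k →ₐ[ℂ] CW n k :=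
  GradedTensorProduct.lift (cliffGrading n) (Weyl.grading k)
    ((inclCliff n k).comp CliffordAlgebra.involute) ((inclWeyl n k).comp (Weyl.parity k))
    (by
      intro i j a b
      rw [AlgHom.comp_apply, AlgHom.comp_apply]
      exact inclCliff_mul_inclWeyl ((CliffordAlgebra.involute_mem_evenOdd_iff _).mpr a.2)
        (parity_mem_grading b.2))

lemma totalParity_inclCliff (a : Cliff n) :
    totalParity n k (inclCliff n k a) = inclCliff n k (CliffordAlgebra.involute a) := by
  rw [GradedTensorProduct.includeLeft_apply, totalParity, GradedTensorProduct.lift_tmul, map_one,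
    mul_one, AlgHom.comp_apply]

lemma totalParity_inclWeyl (b : Weyl k) :
    totalParity n k (inclWeyl n k b) = inclWeyl n k (Weyl.parity k b) := by
  rw [GradedTensorProduct.includeRight_apply, totalParity, GradedTensorProduct.lift_tmul, map_one,
    one_mul, AlgHom.comp_apply]

/-- The generators, numbered like the basis of `ℂ^(n|2k)` and scaled such that their relations are
given by the form of `osp(n, 2k)`: `ω_i`, then `2 q_i`, then `p_i`. -/
def gen : Osp.Idx n k → CW n k
  | Sum.inl i => inclCliff n k (CliffordAlgebra.ι (sumSq n) (Pi.single i 1))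
  | Sum.inr (Sum.inl i) => (2 : ℂ) • inclWeyl n k (Weyl.gen (Sum.inr i))
  | Sum.inr (Sum.inr i) => inclWeyl n k (Weyl.gen (Sum.inl i))

lemma totalParity_gen (a : Osp.Idx n k) : totalParity n k (gen a) = -gen a := by
  rcases a with i | i | i
  · rw [gen, totalParity_inclCliff, CliffordAlgebra.involute_ι, map_neg]
  · rw [gen, map_smul, totalParity_inclWeyl, Weyl.parity_gen, map_neg, smul_neg]
  · rw [gen, totalParity_inclWeyl, Weyl.parity_gen, map_neg]

lemma gen_mem_weylGrading (u : Fin k ⊕ Fin k) : Weyl.gen u ∈ Weyl.grading k 1 := by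
  rw [Weyl.mem_grading, Weyl.parity_gen]
  simp [ZMod.val_one]

lemma ι_single_mul_ι_single (i j : Fin n) :
    CliffordAlgebra.ι (sumSq n) (Pi.single i 1) * CliffordAlgebra.ι (sumSq n) (Pi.single j 1) +
      CliffordAlgebra.ι (sumSq n) (Pi.single j 1) * CliffordAlgebra.ι (sumSq n) (Pi.single i 1) =
      (if i = j then (2 : ℂ) else 0) • (1 : Cliff n) := by
  rw [CliffordAlgebra.ι_mul_ι_add_swap, Algebra.algebraMap_eq_smul_one]
  congr 1
  have hQ : ∀ v : Fin n → ℂ, sumSq n v = ∑ l, v l * v l := fun v => by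
    simp [QuadraticMap.weightedSumSquares_apply]
  have h : QuadraticMap.polar (sumSq n) (Pi.single i 1) (Pi.single j 1) =
      ∑ l, 2 * ((Pi.single i (1 : ℂ) : Fin n → ℂ) l * (Pi.single j (1 : ℂ) : Fin n → ℂ) l) := by
    simp only [QuadraticMap.polar, hQ, Pi.add_apply]
    rw [← Finset.sum_sub_distrib, ← Finset.sum_sub_distrib]
    exact Finset.sum_congr rfl fun l _ => by ring
  rw [h]
  simp [Pi.single_apply, eq_comm]

lemma inclWeyl_gen_mul (u v : Fin k ⊕ Fin k) :
    inclWeyl n k (Weyl.gen u) * inclWeyl n k (Weyl.gen v) =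
      inclWeyl n k (Weyl.gen v) * inclWeyl n k (Weyl.gen u) + poisson u v • (1 : CW n k) := by
  rw [← map_mul, Weyl.gen_mul_gen, map_add, map_mul, AlgHom.commutes, Algebra.algebraMap_eq_smul_one]

lemma inclCliff_mul_inclWeyl_gen (v : Fin n → ℂ) (u : Fin k ⊕ Fin k) :
    inclCliff n k (CliffordAlgebra.ι (sumSq n) v) * inclWeyl n k (Weyl.gen u) =
      -(inclWeyl n k (Weyl.gen u) * inclCliff n k (CliffordAlgebra.ι (sumSq n) v)) := by
  rw [inclCliff_mul_inclWeyl (CliffordAlgebra.ι_mem_evenOdd_one _ _) (gen_mem_weylGrading u)]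
  simp

lemma isGenerators_gen : Osp.IsGenerators (grading n k) (gen : Osp.Idx n k → CW n k) where
  mem a := by
    have hw : ∀ u : Fin k ⊕ Fin k, inclWeyl n k (Weyl.gen u) ∈ grading n k 1 := fun u =>
      tmul_mem_grading n k 1 (gen_mem_weylGrading u)
    rcases a with i | i | i
    · exact tmul_mem_grading n k _ (SetLike.one_mem_graded (Weyl.grading k))
    · exact Submodule.smul_mem _ _ (hw _)
    · exact hw _
  rel a b := by
    have h1 : (ZMod.val (1 : ZMod 2)) = 1 := rfl
    rcases a with i | i | i <;> rcases b with j | j | j <;>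
      simp only [gen, Osp.form, Osp.sgn, Osp.deg, Matrix.fromBlocks_apply₁₁,
        Matrix.fromBlocks_apply₁₂, Matrix.fromBlocks_apply₂₁, Matrix.fromBlocks_apply₂₂, Matrix.J,
        Sum.elim_inl, Sum.elim_inr, h1, ZMod.val_zero, Matrix.zero_apply, Matrix.one_apply,
        Matrix.neg_apply]
    · rw [eq_sub_iff_add_eq, mul_zero, pow_zero, one_smul, ← map_mul (inclCliff n k),
        ← map_mul (inclCliff n k), ← map_add,
        ι_single_mul_ι_single, map_smul, map_one]
      congr 1
      split_ifs <;> simp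
    · rw [mul_smul_comm, inclCliff_mul_inclWeyl_gen]
      simp
    · rw [inclCliff_mul_inclWeyl_gen]
      simp
    · rw [mul_smul_comm, inclCliff_mul_inclWeyl_gen]
      simp
    · simp only [mul_smul_comm, smul_mul_assoc]
      rw [inclWeyl_gen_mul]
      simp [poisson]
    · simp only [mul_smul_comm, smul_mul_assoc]
      rw [inclWeyl_gen_mul]
      by_cases h : i = j <;> simp [poisson, h]
      module
    · rw [inclCliff_mul_inclWeyl_gen]
      simp
    · simp only [mul_smul_comm, smul_mul_assoc]
      rw [inclWeyl_gen_mul]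
      by_cases h : i = j <;> simp [poisson, h]
      module
    · rw [inclWeyl_gen_mul]
      simp [poisson]

lemma nondegenerate_pairs_gen : Osp.Nondegenerate (Osp.pairs (gen : Osp.Idx n k → CW n k)) :=
  isGenerators_gen.nondegenerate_pairs (totalParity n k) totalParity_gen

variable (n k) in
lemma V0_eq : V0 n k = Submodule.span ℂ (gen '' {a | Osp.deg a = 0}) := by
  rw [V0]
  congr 1
  ext y
  constructor
  · rintro ⟨i, rfl⟩
    exact ⟨Sum.inl i, rfl, rfl⟩
  · rintro ⟨i | i, hi, rfl⟩
    · exact ⟨i, rfl⟩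
    · exact absurd hi (by simp [Osp.deg])

variable (n k) in
lemma V1_eq : V1 n k = Submodule.span ℂ (gen '' {a | Osp.deg a = 1}) := by
  rw [V1]
  apply le_antisymm <;> rw [Submodule.span_le]
  · rintro _ ⟨i | i, rfl⟩
    · exact Submodule.subset_span ⟨Sum.inr (Sum.inr i), rfl, rfl⟩
    · have h : inclWeyl n k (Weyl.gen (Sum.inr i)) = (2⁻¹ : ℂ) • gen (Sum.inr (Sum.inl i)) := by
        rw [gen, smul_smul, inv_mul_cancel₀ two_ne_zero, one_smul]
      change inclWeyl n k (Weyl.gen (Sum.inr i)) ∈ _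
      rw [h]
      exact Submodule.smul_mem _ _ (Submodule.subset_span ⟨_, rfl, rfl⟩)
  · rintro _ ⟨i | i | i, hi, rfl⟩
    · exact absurd hi (by simp [Osp.deg])
    · exact Submodule.smul_mem _ _ (Submodule.subset_span ⟨_, rfl⟩)
    · exact Submodule.subset_span ⟨_, rfl⟩

end CW

namespace Osp

/-! ### Decompositions into blocks -/

section Decompose

variable {m k : ℕ} {A : Type*} [Ring A] [Algebra ℂ A] {𝒜 : ZMod 2 → Submodule ℂ A}
  {T : Idx m k → Idx m k → A} {P P' P'' Q : Idx m k → Idx m k → Prop}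

lemma block_sup : block T P ⊔ block T P' = block T (fun a b => P a b ∨ P' a b) := by
  rw [block, block, ← Submodule.span_union, block]
  congr 1
  ext y
  constructor
  · rintro (⟨a, b, h, rfl⟩ | ⟨a, b, h, rfl⟩)
    · exact ⟨a, b, Or.inl h, rfl⟩
    · exact ⟨a, b, Or.inr h, rfl⟩
  · rintro ⟨a, b, h | h, rfl⟩
    · exact Or.inl ⟨a, b, h, rfl⟩
    · exact Or.inr ⟨a, b, h, rfl⟩

lemma IsPairSymbol.isDirectSum_pair (hT : IsPairSymbol 𝒜 T) (hnd : Nondegenerate T)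
    (hP : ∀ a b, P a b → P b a) (hP' : ∀ a b, P' a b → P' b a) (hdisj : ∀ a b, P a b → ¬ P' a b)
    (hQ : ∀ a b, Q a b ↔ P a b ∨ P' a b) :
    IsDirectSum (block T Q) ![block T P, block T P'] := by
  have h : ![block T P, block T P'] = fun i => block T (![P, P'] i) := by
    ext i : 1
    fin_cases i <;> rfl
  rw [h]
  refine hT.isDirectSum_block hnd (fun a b => ?_) (fun i => ?_) (fun i j a b => ?_)
  · rw [hQ, Fin.exists_fin_two]
    rfl
  · fin_cases i
    · exact hP
    · exact hP'
  · have h := hdisj a b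
    fin_cases i <;> fin_cases j <;> simp <;> tauto

lemma IsPairSymbol.isDirectSum_triple (hT : IsPairSymbol 𝒜 T) (hnd : Nondegenerate T)
    (hP : ∀ a b, P a b → P b a) (hP' : ∀ a b, P' a b → P' b a) (hP'' : ∀ a b, P'' a b → P'' b a)
    (h1 : ∀ a b, P a b → ¬ P' a b) (h2 : ∀ a b, P a b → ¬ P'' a b) (h3 : ∀ a b, P' a b → ¬ P'' a b)
    (hQ : ∀ a b, Q a b ↔ P a b ∨ P' a b ∨ P'' a b) :
    IsDirectSum (block T Q) ![block T P, block T P', block T P''] := by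
  have h : ![block T P, block T P', block T P''] = fun i => block T (![P, P', P''] i) := by
    ext i : 1
    fin_cases i <;> rfl
  rw [h]
  refine hT.isDirectSum_block hnd (fun a b => ?_) (fun i => ?_) (fun i j a b => ?_)
  · rw [hQ, Fin.exists_fin_succ, Fin.exists_fin_two]
    rfl
  · fin_cases i
    · exact hP
    · exact hP'
    · exact hP''
  · have h1 := h1 a b
    have h2 := h2 a b
    have h3 := h3 a b
    fin_cases i <;> fin_cases j <;> simp <;> tauto

end Decompose

section Relations

variable {n k : ℕ}

lemma idx_cases (a : Idx (n + 1) k) :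
    a = zero n k ∨ (a ≠ zero n k ∧ deg a = 0) ∨ (a ≠ zero n k ∧ deg a = 1) := by
  by_cases h : a = zero n k
  · exact Or.inl h
  · exact Or.inr ((deg_eq_zero_or_one a).imp (⟨h, ·⟩) (⟨h, ·⟩))

lemma add_eq_zero_iff_rel (a b : Idx (n + 1) k) :
    deg a + deg b = 0 ↔ linRel 0 a b ∨ quadRel 0 0 a b ∨ quadRel 1 1 a b := by
  rcases idx_cases a with rfl | ⟨h1, h2⟩ | ⟨h1, h2⟩ <;>
  rcases idx_cases b with rfl | ⟨h3, h4⟩ | ⟨h3, h4⟩ <;>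
  simp [linRel, quadRel, *, CharTwo.add_self_eq_zero]

lemma add_eq_one_iff_rel (a b : Idx (n + 1) k) :
    deg a + deg b = 1 ↔ linRel 1 a b ∨ quadRel 0 1 a b := by
  rcases idx_cases a with rfl | ⟨h1, h2⟩ | ⟨h1, h2⟩ <;>
  rcases idx_cases b with rfl | ⟨h3, h4⟩ | ⟨h3, h4⟩ <;>
  simp [linRel, quadRel, *, CharTwo.add_self_eq_zero]

lemma even_even_iff_rel (a b : Idx (n + 1) k) :
    deg a = 0 ∧ deg b = 0 ↔ linRel 0 a b ∨ quadRel 0 0 a b := by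
  rcases idx_cases a with rfl | ⟨h1, h2⟩ | ⟨h1, h2⟩ <;>
  rcases idx_cases b with rfl | ⟨h3, h4⟩ | ⟨h3, h4⟩ <;>
  simp [linRel, quadRel, *, CharTwo.add_self_eq_zero]

lemma odd_odd_iff_rel (a b : Idx (n + 1) k) : deg a = 1 ∧ deg b = 1 ↔ quadRel 1 1 a b := by
  rcases idx_cases a with rfl | ⟨h1, h2⟩ | ⟨h1, h2⟩ <;>
  rcases idx_cases b with rfl | ⟨h3, h4⟩ | ⟨h3, h4⟩ <;>
  simp [quadRel, *]

lemma zero_or_zero_iff_rel (a b : Idx (n + 1) k) :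
    (a = zero n k ∨ b = zero n k) ↔ linRel 0 a b ∨ linRel 1 a b := by
  rcases idx_cases a with rfl | ⟨h1, h2⟩ | ⟨h1, h2⟩ <;>
  rcases idx_cases b with rfl | ⟨h3, h4⟩ | ⟨h3, h4⟩ <;>
  simp [linRel, *]

lemma ne_zero_and_ne_zero_iff_rel (a b : Idx (n + 1) k) :
    (a ≠ zero n k ∧ b ≠ zero n k) ↔ quadRel 0 0 a b ∨ quadRel 1 1 a b ∨ quadRel 0 1 a b := by
  rcases idx_cases a with rfl | ⟨h1, h2⟩ | ⟨h1, h2⟩ <;>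
  rcases idx_cases b with rfl | ⟨h3, h4⟩ | ⟨h3, h4⟩ <;>
  simp [quadRel, *]

lemma linRel_not_quadRel {d c c' : ZMod 2} (a b : Idx (n + 1) k) (h : linRel d a b) :
    ¬ quadRel c c' a b := by
  rintro ⟨ha, hb, -⟩
  exact h.1.elim ha hb

lemma linRel_zero_not_linRel_one (a b : Idx (n + 1) k) (h : linRel 0 a b) : ¬ linRel 1 a b :=
  fun h' => zero_ne_one (h.2.symm.trans h'.2)

lemma exists_succ_iff (P : Idx n k → Idx n k → Prop) (Q : Idx (n + 1) k → Idx (n + 1) k → Prop)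
    (h : ∀ a b, P a b ↔ Q (succ a) (succ b)) (hl : ∀ b, ¬ Q (zero n k) b)
    (hr : ∀ a, ¬ Q a (zero n k)) (c d : Idx (n + 1) k) :
    (∃ a b, P a b ∧ succ a = c ∧ succ b = d) ↔ Q c d := by
  constructor
  · rintro ⟨a, b, hab, rfl, rfl⟩
    exact (h a b).mp hab
  · intro hQ
    obtain rfl | ⟨a, rfl⟩ := eq_zero_or_succ c
    · exact absurd hQ (hl d)
    obtain rfl | ⟨b, rfl⟩ := eq_zero_or_succ d
    · exact absurd hQ (hr _)
    exact ⟨a, b, (h a b).mpr hQ, rfl, rfl⟩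

variable (n k) in
/-- The inclusion of the basis of `ℂ^(1|2k)` in that of `ℂ^(n+1|2k)`. -/
def inclOne : Idx 1 k → Idx (n + 1) k := Sum.map (fun _ => 0) id

lemma inclOne_injective : Function.Injective (inclOne n k) :=
  Function.Injective.sumMap (Function.injective_of_subsingleton _) Function.injective_id

lemma deg_inclOne (a : Idx 1 k) : deg (inclOne n k a) = deg a := by
  rcases a with a | a <;> rfl

lemma form_inclOne (a b : Idx 1 k) :
    form (n + 1) k (inclOne n k a) (inclOne n k b) = form 1 k a b := by
  rcases a with a | a <;> rcases b with b | b
  · rw [Subsingleton.elim a b]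
    simp [form, inclOne]
  · simp [form, inclOne]
  · simp [form, inclOne]
  · simp [form, inclOne]

lemma exists_inclOne {c : Idx (n + 1) k} (h : c = zero n k ∨ deg c = 1) :
    ∃ a, inclOne n k a = c := by
  rcases h with rfl | h
  · exact ⟨Sum.inl 0, rfl⟩
  · rcases c with c | c
    · exact absurd h (by simp [deg])
    · exact ⟨Sum.inr c, rfl⟩

lemma inclOne_eq (a : Idx 1 k) : inclOne n k a = zero n k ∨ deg (inclOne n k a) = 1 := by
  rcases a with a | a
  · exact Or.inl rfl
  · exact Or.inr rfl

/-- The pair `(zero, zero)` does not contribute to a block. -/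
lemma block_inclOne {A : Type*} [Ring A] [Algebra ℂ A] (e : Idx n k → A) :
    block (pairs e) (fun c d => ∃ a b, True ∧ inclOne n k a = c ∧ inclOne n k b = d) =
      block (pairs e) (fun a b => linRel 1 a b ∨ quadRel 1 1 a b) := by
  apply le_antisymm
  · rw [block, Submodule.span_le]
    rintro _ ⟨_, _, ⟨a, b, -, rfl, rfl⟩, rfl⟩
    have ha := inclOne_eq (n := n) a
    have hb := inclOne_eq (n := n) b
    generalize inclOne n k a = c at *
    generalize inclOne n k b = d at *
    by_cases h : c = zero n k ∧ d = zero n k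
    · rw [h.1, h.2]
      simp
    · refine Submodule.subset_span ⟨c, d, ?_, rfl⟩
      by_cases h1 : c = zero n k <;> by_cases h2 : d = zero n k <;> simp_all [linRel, quadRel]
  · refine block_mono fun c d h => ?_
    have hcd : (c = zero n k ∨ deg c = 1) ∧ (d = zero n k ∨ deg d = 1) := by
      rcases h with ⟨rfl | rfl, h⟩ | ⟨-, -, h⟩
      · exact ⟨Or.inl rfl, Or.inr (by simpa using h)⟩
      · exact ⟨Or.inr (by simpa using h), Or.inl rfl⟩
      · tauto
    obtain ⟨a, ha⟩ := exists_inclOne hcd.1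
    obtain ⟨b, hb⟩ := exists_inclOne hcd.2
    exact ⟨a, b, trivial, ha, hb⟩

end Relations

end Osp

end CliffordWeyl

end

open CliffordWeyl CliffordWeyl.Osp CliffordWeyl.CW in
theorem proposition4p1 (n k : ℕ) :
    CliffordWeyl.IsDirectSum (CliffordWeyl.CW.V n k)
      ![CliffordWeyl.CW.V0 n k, CliffordWeyl.CW.V1 n k] ∧
    ∃ 𝔤 : CliffordWeyl.LieSubsuperalgebra (CliffordWeyl.CW.grading n k),
      -- `𝔤 = V ⊕ [V, V]`, isomorphic to `osp(n + 1, 2k)`, and generated by `V`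
      CliffordWeyl.IsDirectSum 𝔤.toSubmodule
        ![CliffordWeyl.CW.V n k,
          CliffordWeyl.CW.br (CliffordWeyl.CW.V n k) (CliffordWeyl.CW.V n k)] ∧
      𝔤.Iso (CliffordWeyl.Osp.osp (n + 1) k) ∧
      (∀ L : CliffordWeyl.LieSubsuperalgebra (CliffordWeyl.CW.grading n k),
        CliffordWeyl.CW.V n k ≤ L.toSubmodule → 𝔤.toSubmodule ≤ L.toSubmodule) ∧
      -- the even part
      CliffordWeyl.IsDirectSum (𝔤.part 0)
        ![CliffordWeyl.CW.V0 n k,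
          CliffordWeyl.CW.br (CliffordWeyl.CW.V0 n k) (CliffordWeyl.CW.V0 n k),
          CliffordWeyl.CW.br (CliffordWeyl.CW.V1 n k) (CliffordWeyl.CW.V1 n k)] ∧
      (∃ 𝔞 : CliffordWeyl.LieSubsuperalgebra (CliffordWeyl.CW.grading n k),
        𝔞.toSubmodule = CliffordWeyl.CW.br (CliffordWeyl.CW.V0 n k) (CliffordWeyl.CW.V0 n k) ∧
        𝔞.IsoLie (LieAlgebra.Orthogonal.so (Fin n) ℂ)) ∧
      (∃ 𝔟 : CliffordWeyl.LieSubsuperalgebra (CliffordWeyl.CW.grading n k),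
        𝔟.toSubmodule = CliffordWeyl.CW.br (CliffordWeyl.CW.V1 n k) (CliffordWeyl.CW.V1 n k) ∧
        𝔟.IsoLie (LieAlgebra.Symplectic.sp (Fin k) ℂ)) ∧
      (∃ 𝔠 : CliffordWeyl.LieSubsuperalgebra (CliffordWeyl.CW.grading n k),
        CliffordWeyl.IsDirectSum 𝔠.toSubmodule
          ![CliffordWeyl.CW.V0 n k,
            CliffordWeyl.CW.br (CliffordWeyl.CW.V0 n k) (CliffordWeyl.CW.V0 n k)] ∧
        𝔠.IsoLie (LieAlgebra.Orthogonal.so (Fin (n + 1)) ℂ)) ∧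
      𝔤.even.IsoLie
        (LieAlgebra.Orthogonal.so (Fin (n + 1)) ℂ × LieAlgebra.Symplectic.sp (Fin k) ℂ) ∧
      -- the odd part
      CliffordWeyl.IsDirectSum (𝔤.part 1)
        ![CliffordWeyl.CW.V1 n k,
          CliffordWeyl.CW.br (CliffordWeyl.CW.V0 n k) (CliffordWeyl.CW.V1 n k)] ∧
      -- `V_1 ⊕ [V_1, V_1]`, isomorphic to `osp(1, 2k)`
      (∃ 𝔡 : CliffordWeyl.LieSubsuperalgebra (CliffordWeyl.CW.grading n k),
        CliffordWeyl.IsDirectSum 𝔡.toSubmodule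
          ![CliffordWeyl.CW.V1 n k,
            CliffordWeyl.CW.br (CliffordWeyl.CW.V1 n k) (CliffordWeyl.CW.V1 n k)] ∧
        𝔡.Iso (CliffordWeyl.Osp.osp 1 k)) ∧
      -- `𝔥 = [V, V]`, isomorphic to `osp(n, 2k)`
      ∃ 𝔥 : CliffordWeyl.LieSubsuperalgebra (CliffordWeyl.CW.grading n k),
        CliffordWeyl.IsDirectSum 𝔥.toSubmodule
          ![CliffordWeyl.CW.br (CliffordWeyl.CW.V0 n k) (CliffordWeyl.CW.V0 n k),
            CliffordWeyl.CW.br (CliffordWeyl.CW.V1 n k) (CliffordWeyl.CW.V1 n k),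
            CliffordWeyl.CW.br (CliffordWeyl.CW.V0 n k) (CliffordWeyl.CW.V1 n k)] ∧
        𝔥.toSubmodule = CliffordWeyl.CW.br (CliffordWeyl.CW.V n k) (CliffordWeyl.CW.V n k) ∧
        𝔥.Iso (CliffordWeyl.Osp.osp n k) := by
  have hgen := isGenerators_gen (n := n) (k := k)
  have hT := hgen.isPairSymbol
  have hnd := nondegenerate_pairs_gen (n := n) (k := k)
  -- all subspaces of the statement are blocks
  have hV0 : V0 n k = block (pairs gen) (linRel 0) := by rw [V0_eq, block_linRel]
  have hV1 : V1 n k = block (pairs gen) (linRel 1) := by rw [V1_eq, block_linRel]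
  have h00 : br (V0 n k) (V0 n k) = block (pairs gen) (quadRel 0 0) := by
    rw [V0_eq, block_quadRel hgen]
  have h11 : br (V1 n k) (V1 n k) = block (pairs gen) (quadRel 1 1) := by
    rw [V1_eq, block_quadRel hgen]
  have h01 : br (V0 n k) (V1 n k) = block (pairs gen) (quadRel 0 1) := by
    rw [V0_eq, V1_eq, block_quadRel hgen]
  have h10 : br (V1 n k) (V0 n k) = block (pairs gen) (quadRel 0 1) := by
    rw [V0_eq, V1_eq]
    refine (block_quadRel hgen 1 0).symm.trans (block_congr fun a b => ?_)
    unfold quadRel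
    tauto
  have hV : V n k = block (pairs gen) (fun a b => a = zero n k ∨ b = zero n k) := by
    rw [V, hV0, hV1, block_sup]
    exact block_congr fun a b => (zero_or_zero_iff_rel a b).symm
  have hVV : br (V n k) (V n k) =
      block (pairs gen) (fun a b => a ≠ zero n k ∧ b ≠ zero n k) := by
    have h : br (V n k) (V n k) = (br (V0 n k) (V0 n k) ⊔ br (V0 n k) (V1 n k)) ⊔
        (br (V1 n k) (V0 n k) ⊔ br (V1 n k) (V1 n k)) := by
      simp only [br, bracketSpan, V, Submodule.map₂_sup_left, Submodule.map₂_sup_right]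
      exact sup_sup_sup_comm _ _ _ _
    rw [h, h00, h01, h10, h11, block_sup, block_sup, block_sup]
    refine block_congr fun a b => ?_
    rw [ne_zero_and_ne_zero_iff_rel]
    tauto
  have hform : ∀ a b : Idx n k, form (n + 1) k (succ a) (succ b) = form n k a b := form_succ_succ
  have hTs := hT.restrict deg_succ hform
  have hnds := hnd.restrict succ_injective deg_succ
  have hTo := hT.restrict (deg_inclOne (n := n)) form_inclOne
  have hndo := hnd.restrict inclOne_injective (deg_inclOne (n := n))
  have hq : ∀ a b : Idx (n + 1) k, quadRel 0 0 a b → ¬ quadRel 1 1 a b := by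
    rintro a b ⟨-, -, h⟩ ⟨-, -, h'⟩
    simp_all
  have hq' : ∀ a b : Idx (n + 1) k, quadRel 0 0 a b → ¬ quadRel 0 1 a b := by
    rintro a b ⟨-, -, h⟩ ⟨-, -, h'⟩
    simp_all
  have hq'' : ∀ a b : Idx (n + 1) k, quadRel 1 1 a b → ¬ quadRel 0 1 a b := by
    rintro a b ⟨-, -, h⟩ ⟨-, -, h'⟩
    simp_all
  refine ⟨?_, ?_⟩
  · rw [hV, hV0, hV1]
    exact hT.isDirectSum_pair hnd linRel_symm linRel_symm linRel_zero_not_linRel_one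
      zero_or_zero_iff_rel
  obtain ⟨𝔤, h𝔤, h𝔤iso⟩ := hT.exists_iso_osp hnd
  have hpart : ∀ s, 𝔤.part s = block (pairs gen) (fun a b => deg a + deg b = s) := by
    intro s
    rw [LieSubsuperalgebra.part, h𝔤]
    exact hT.block_inf s
  have h𝔤sum : IsDirectSum 𝔤.toSubmodule ![V n k, br (V n k) (V n k)] := by
    rw [h𝔤, hVV, hV]
    exact hT.isDirectSum_pair hnd (fun _ _ h => h.symm) (fun _ _ h => h.symm)
      (fun a b h h' => h.elim h'.1 h'.2) (fun a b => by tauto)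
  refine ⟨𝔤, h𝔤sum, h𝔤iso, ?_, ?_, ?_, ?_, ?_, ?_, ?_, ?_, ?_⟩
  · intro L hL
    rw [← h𝔤sum.2]
    refine iSup_le fun i => ?_
    fin_cases i
    · exact hL
    · exact Submodule.map₂_le.mpr fun x hx y hy => L.bracket_mem' (hL hx) (hL hy)
  · rw [hpart, h00, h11, hV0]
    exact hT.isDirectSum_triple hnd linRel_symm quadRel_symm quadRel_symm linRel_not_quadRel
      linRel_not_quadRel hq add_eq_zero_iff_rel
  · obtain ⟨L, hL, hiso⟩ := hTs.exists_isoLie_so hnds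
    refine ⟨L, ?_, hiso⟩
    rw [hL, h00, block_restrict hform]
    exact block_congr (exists_succ_iff _ _ (fun a b => by simp [quadRel, succ_ne_zero])
      (by simp [quadRel]) (by simp [quadRel]))
  · obtain ⟨L, hL, hiso⟩ := hT.exists_isoLie_sp hnd
    refine ⟨L, ?_, hiso⟩
    rw [hL, h11]
    exact block_congr odd_odd_iff_rel
  · obtain ⟨L, hL, hiso⟩ := hT.exists_isoLie_so hnd
    refine ⟨L, ?_, hiso⟩
    rw [hL, h00, hV0]
    exact hT.isDirectSum_pair hnd linRel_symm quadRel_symm linRel_not_quadRel even_even_iff_rel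
  · refine hT.isoLie_so_prod_sp hnd _ ((hpart 0).trans (block_congr fun a b => ?_))
    rw [CharTwo.add_eq_zero]
  · rw [hpart, h01, hV1]
    exact hT.isDirectSum_pair hnd linRel_symm quadRel_symm linRel_not_quadRel add_eq_one_iff_rel
  · obtain ⟨L, hL, hiso⟩ := hTo.exists_iso_osp hndo
    refine ⟨L, ?_, hiso⟩
    rw [hL, block_restrict form_inclOne, block_inclOne, h11, hV1]
    exact hT.isDirectSum_pair hnd linRel_symm quadRel_symm linRel_not_quadRel fun _ _ => Iff.rfl
  · obtain ⟨L, hL, hiso⟩ := hTs.exists_iso_osp hnds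
    have hL' : L.toSubmodule = br (V n k) (V n k) := by
      rw [hL, hVV, block_restrict hform]
      exact block_congr (exists_succ_iff _ _ (fun a b => by simp [succ_ne_zero]) (by simp)
        (by simp))
    refine ⟨L, ?_, hL', hiso⟩
    rw [hL', hVV, h00, h11, h01]
    exact hT.isDirectSum_triple hnd quadRel_symm quadRel_symm quadRel_symm hq hq' hq''
      ne_zero_and_ne_zero_iff_rel
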